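/- **Theorem 4.9 (label theoremyaonoor2).** Let $H$ be a real Hilbert space, $T:H\to 2^H$ a maximal monotone operator with set of zeros $S=T^{-1}(0)$, and for $c>0$ let $\mathsf J_c=(I+cT)^{-1}$ be its resolvent function. Let $u,z_0\in H$, let $(e_n)$ be a sequence in $H$, let $c_n>0$ and $\lambda_n,\gamma_n,\delta_n\in(0,1)$ with $\lambda_n+\gamma_n+\delta_n=1$ for all $n\in\mathbb N$, and let $$z_{n+1}=\lambda_n u+\gamma_n z_n+\delta_n\mathsf J_{c_n}(z_n)+e_n\qquad(n\in\mathbb N).$$ Let $a,c\in\mathbb N\setminus\{0\}$ and let $\ell,L,\Gamma,E:\mathbb N\to\mathbb N$ be monotone (non-decreasing) functions such that - $(Q_1)$ $\lambda_n\le\frac1{k+1}$ for all $k$ and all $n\ge\ell(k)$; - $(Q_2)$ $\sum_{i=1}^{L(k)}\lambda_i\ge k$ for all $k$; - $(Q_3)$ $\frac1a\le\gamma_m\le1-\frac1a$ for all $m$; - $(Q_4)$ $c_n\ge\frac1c$ for all $n$; - $(Q_5)$ $|c_{n+1}-c_n|\le\frac1{k+1}$ for all $k$ and all $n\ge\Gamma(k)$;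 - $(Q_6)$ $\sum_{i=E(k)+1}^{E(k)+n}\|e_i\|\le\frac1{k+1}$ for all $k,n$. Let $\mathcal C:\mathbb N\to\mathbb N$ be monotone with $c_n\le\mathcal C(n)$ for all $n$, and let $N_1,N_2,N_3\in\mathbb N$ be such that $N_1\ge\|u\|$, $N_2\ge\sum_{i=0}^{E(0)}\|e_i\|+1$ and, for some $s\in S$, $N_3\ge\max\{\|u-s\|,\|z_0-s\|\}$. Then $$\forall k\in\mathbb N\ \forall f:\mathbb N\to\mathbb N\ \exists n\le\phi(k,f)\ \forall i,j\in[n,n+f(n)]\ \Big(\|z_i-z_j\|\le\tfrac1{k+1}\Big),$$ where $\phi(k,f)$ depends only on $k,f,a,c,\ell,L,\Gamma,E,\mathcal C,N_1,N_2,N_3$ and is defined as follows. Put $N_0=N_2+N_3$, $N=\max\{2N_3,N_2+N_3\}$, $M_1=3N_2+4N$, $M_2=M_1+2(N_3+N)$, $f^{\mathrm{maj}}(n)=\max_{i\le n}f(i)$, and let $F^{(r)}$ denote the $r$-fold iterate of $F$. Then: 1. $\theta(k,M,t,K,f)=M+(P-1)t+r_0$ with $P=K(k+1)$, $r_P=0$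 and $r_i=t+r_{i+1}+f(M+(i+1)t+r_{i+1})$ for $i<P$. 2. $\nu(k)=\max\{\Gamma(10acN_0(k+1)),\ \ell(10a(N_0+N_1+N_3)(k+1)),\ E(5a(k+1))+1\}$. 3. $\chi_0(k,f)=\theta\big(\rho-1,\ \max\{a,\nu(\rho-1)\},\ t,\ 2K,\ m\mapsto t+f(m)\big)$ with $K=2aN_0+N_1+N_3$, $t=\max\{2Ka(k+1),1\}$ and $\rho=t(2t+1)a^t(k+1)$. 4. $\mu(k)=\max\{\ell(4a(k+1)(N_0+N_3)),\ E(4a(k+1))+1\}$ and $\xi(k,f)=\max\{\mu(2k+1),\ \chi_0(4a(k+1),\tilde f)\}$ with $\tilde f(m)=\mu(2k+1)+f(\max\{\mu(2k+1),m\})$. 5. $\psi(k,f)=\xi\big(24N(\check g^{(R)}(0)+1)^2,\ f+1\big)$ with $R=N^4(k+1)^2$, $g(m)=f(\xi(m,f+1))$ and $\check g(m)=\max\{g(24N(m+1)^2),\ 24N(m+1)^2\}$. 6. $\Psi(k,f)=\psi(2k+1,h_f)$ with $h_f(m)=\mathcal C(f(m))\,c\,(1+4N)(f(m)+1)-1$.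 7. $\Theta(k,f)=L\big(h(\Psi(4k+3,g))\big)+1$ with $D=4N^2$, $G(i)=E(M_2(i+1))$, $h(m)=\max\{m,G(4k+3)+1\}+\lceil\ln(4D(k+1))\rceil$ and $g(m)=4(k+1)\big(f(L(h(m))+1)+1\big)$. 8. $\phi(k,f)=\Theta\big(4(k+1)^2-1,\ m\mapsto m+f^{\mathrm{maj}}(m)\big)$. -/

import Mathlib

namespace MPPA

/-! ### Monotone operators and resolvents -/

section Operators

variable {H : Type*} [NormedAddCommGroup H] [InnerProductSpace ℝ H]

/-- A multi-valued operator `T : H → 2^H` is monotone if `⟨x - x', y - y'⟩ ≥ 0` for all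
`(x, y)`, `(x', y')` in its graph. -/
def IsMonotoneOperator (T : H → Set H) : Prop :=
  ∀ x x' : H, ∀ y ∈ T x, ∀ y' ∈ T x', 0 ≤ inner ℝ (x - x') (y - y')

/-- A monotone operator is maximal if its graph is not properly contained in the graph of
another monotone operator. -/
def IsMaximalMonotone (T : H → Set H) : Prop :=
  IsMonotoneOperator T ∧
    ∀ T' : H → Set H, IsMonotoneOperator T' → (∀ x, T x ⊆ T' x) → T' = T

/-- The set `S = T⁻¹(0)` of zeros of `T`. -/
def zeros (T : H → Set H) : Set H := {x | 0 ∈ T x}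

/-- `InResolvent T c x y` says that `y ∈ (I + cT)⁻¹ x`, that is `x ∈ y + c T y`. -/
def InResolvent (T : H → Set H) (c : ℝ) (x y : H) : Prop := ∃ v ∈ T y, x = y + c • v

open Classical in
/-- The resolvent function `J_c = (I + cT)⁻¹`. For `T` monotone and `c > 0` there is at most one
point `y ∈ (I + cT)⁻¹ x` (see `resolvent_eq`), and for `T` maximal monotone on a Hilbert space there
is exactly one, which is the value of the function. The value `0` in case there is none is then
never used. -/
noncomputable def resolvent (T : H → Set H) (c : ℝ) (x : H) : H :=
  if h : ∃ y, InResolvent T c x y then h.choose else 0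

/-- `(I + cT)⁻¹` is single-valued. -/
theorem InResolvent.unique {T : H → Set H} (hT : IsMonotoneOperator T) {c : ℝ} (hc : 0 < c)
    {x y y' : H} (h : InResolvent T c x y) (h' : InResolvent T c x y') : y = y' := by
  obtain ⟨v, hv, rfl⟩ := h
  obtain ⟨v', hv', e⟩ := h'
  have h1 := hT y y' v hv v' hv'
  have h2 : y - y' = -(c • (v - v')) := by
    rw [smul_sub, neg_sub, sub_eq_sub_iff_add_eq_add, e, add_comm]
  rw [h2, inner_neg_left, inner_smul_left, real_inner_self_eq_norm_sq] at h1
  have h3 : ‖v - v'‖ ^ 2 = 0 := by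
    have h4 := sq_nonneg ‖v - v'‖
    simp only [conj_trivial] at h1
    nlinarith
  have h5 : v - v' = 0 := by simpa using h3
  rw [h5, smul_zero, neg_zero] at h2
  exact sub_eq_zero.mp h2

/-- The resolvent function takes the value prescribed by the relation `y ∈ (I + cT)⁻¹ x`. -/
theorem resolvent_eq {T : H → Set H} (hT : IsMonotoneOperator T) {c : ℝ} (hc : 0 < c)
    {x y : H} (h : InResolvent T c x y) : resolvent T c x = y := by
  have hex : ∃ y, InResolvent T c x y := ⟨y, h⟩
  rw [resolvent, dif_pos hex]
  exact InResolvent.unique hT hc hex.choose_spec h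

end Operators

/-! ### The bounding functionals -/

/-- `fmaj f n = max {f i | i ≤ n}`. -/
def fmaj (f : ℕ → ℕ) (n : ℕ) : ℕ := (Finset.range (n + 1)).sup f

/-- With `n_i = M + i t` for `0 ≤ i ≤ P`, let `r_P = 0` and
`r_i = t + r_{i+1} + f (n_{i+1} + r_{i+1})` for `i < P`. Then `rDown f M t P j = r_{P-j}` for
`j ≤ P`; in particular `rDown f M t P P = r_0`. -/
def rDown (f : ℕ → ℕ) (M t P : ℕ) : ℕ → ℕ
  | 0 => 0
  | j + 1 => t + rDown f M t P j + f (M + (P - j) * t + rDown f M t P j)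

/-- `θ(k, M, t, N, f) = M + (P - 1) t + r_0` with `P = N (k + 1)`. -/
def theta (k M t N : ℕ) (f : ℕ → ℕ) : ℕ :=
  M + (N * (k + 1) - 1) * t + rDown f M t (N * (k + 1)) (N * (k + 1))

/-- `R(a, k, t) = t (2t + 1) a^t (k + 1)`. -/
def RSuzuki (a k t : ℕ) : ℕ := t * (2 * t + 1) * a ^ t * (k + 1)

/-- `φ(k, f, l, t, a, ν, N) = θ(R - 1, max {a, l, ν(R - 1)}, t, N, m ↦ t + f m)` with
`R = R(a, k, t)`. -/
def phiSuzuki (k : ℕ) (f : ℕ → ℕ) (l t a : ℕ) (ν : ℕ → ℕ) (N : ℕ) : ℕ :=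
  theta (RSuzuki a k t - 1) (max a (max l (ν (RSuzuki a k t - 1)))) t N (fun m => t + f m)

/-- `χ̃(k, f, a, ν, N) = φ(k, f, a, t, a, ν, 2N)` with `t = max {2 N a (k + 1), 1}`. -/
def chiTilde (k : ℕ) (f : ℕ → ℕ) (a : ℕ) (ν : ℕ → ℕ) (N : ℕ) : ℕ :=
  phiSuzuki k f a (max (2 * N * a * (k + 1)) 1) a ν (2 * N)

/-- `ν(k) = max {Γ(10 a c N₀ (k+1)), ℓ(10 a (N₀+N₁+N₃)(k+1)), E(5a(k+1)) + 1}`,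
with `N₀ = N₂ + N₃`. -/
def nu (a c : ℕ) (ℓ Γ E : ℕ → ℕ) (N₁ N₂ N₃ : ℕ) (k : ℕ) : ℕ :=
  max (Γ (10 * a * c * (N₂ + N₃) * (k + 1)))
    (max (ℓ (10 * a * ((N₂ + N₃) + N₁ + N₃) * (k + 1))) (E (5 * a * (k + 1)) + 1))

/-- `χ₀(k, f) = χ̃(k, f, a, ν, 2 a N₀ + N₁ + N₃)`, with `N₀ = N₂ + N₃`. -/
def chi0 (a c : ℕ) (ℓ Γ E : ℕ → ℕ) (N₁ N₂ N₃ : ℕ) (k : ℕ) (f : ℕ → ℕ) : ℕ :=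
  chiTilde k f a (nu a c ℓ Γ E N₁ N₂ N₃) (2 * a * (N₂ + N₃) + N₁ + N₃)

/-- `μ(k) = max {ℓ(4a(k+1)(N₀+N₃)), E(4a(k+1)) + 1}`, with `N₀ = N₂ + N₃`. -/
def mu (a : ℕ) (ℓ E : ℕ → ℕ) (N₂ N₃ : ℕ) (k : ℕ) : ℕ :=
  max (ℓ (4 * a * (k + 1) * ((N₂ + N₃) + N₃))) (E (4 * a * (k + 1)) + 1)

/-- `ξ_χ(k, f) = max {μ(2k+1), χ(4a(k+1), f̃_{2k+1})}`, where
`f̃_k(m) = μ(k) + f(max {μ(k), m})`. -/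
def xi (a : ℕ) (μ : ℕ → ℕ) (χ : ℕ → (ℕ → ℕ) → ℕ) (k : ℕ) (f : ℕ → ℕ) : ℕ :=
  max (μ (2 * k + 1))
    (χ (4 * a * (k + 1)) (fun m => μ (2 * k + 1) + f (max (μ (2 * k + 1)) m)))

/-- `ǧ(m) = max {g(24 N (m+1)²), 24 N (m+1)²}`. -/
def check (N : ℕ) (g : ℕ → ℕ) (m : ℕ) : ℕ :=
  max (g (24 * N * (m + 1) ^ 2)) (24 * N * (m + 1) ^ 2)

/-- `ψ(k, f) = ξ(24 N (ǧ^{(R)}(0) + 1)², f + 1)`, where `R = N⁴ (k+1)²`,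
`g(m) = f(ξ(m, f + 1))` and `ǧ^{(R)}` is the `R`-fold iterate. -/
def psi (N : ℕ) (ξ : ℕ → (ℕ → ℕ) → ℕ) (k : ℕ) (f : ℕ → ℕ) : ℕ :=
  ξ (24 * N * ((check N (fun m => f (ξ m (fun i => f i + 1))))^[N ^ 4 * (k + 1) ^ 2] 0 + 1) ^ 2)
    (fun i => f i + 1)

/-- `ζ(k, n) = 𝒞(n) c (k+1) - 1`. -/
def zeta (c : ℕ) (C : ℕ → ℕ) (k n : ℕ) : ℕ := C n * c * (k + 1) - 1

/-- `Ψ(k, f) = ψ(2k+1, h)` with `h(m) = ζ((1 + 4N)(f(m)+1) - 1, f(m))`. -/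
def Psi (c : ℕ) (C : ℕ → ℕ) (N : ℕ) (ψ : ℕ → (ℕ → ℕ) → ℕ) (k : ℕ) (f : ℕ → ℕ) : ℕ :=
  ψ (2 * k + 1) (fun m => zeta c C ((1 + 4 * N) * (f m + 1) - 1) (f m))

/-- `h(m) = max {m, G(4k+3) + 1} + ⌈ln(4D(k+1))⌉`. -/
noncomputable def hTheta (k : ℕ) (G : ℕ → ℕ) (D m : ℕ) : ℕ :=
  max m (G (4 * k + 3) + 1) + ⌈Real.log (4 * (D : ℝ) * ((k : ℝ) + 1))⌉₊

/-- `Θ(k, f, L, Ψ, G, D) = L(h(Ψ(4k+3, g))) + 1` with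
`g(m) = 4(k+1)(f(L(h(m)) + 1) + 1)`. -/
noncomputable def Theta (k : ℕ) (f L : ℕ → ℕ) (Ψ : ℕ → (ℕ → ℕ) → ℕ) (G : ℕ → ℕ) (D : ℕ) : ℕ :=
  L (hTheta k G D
      (Ψ (4 * k + 3) (fun m => 4 * (k + 1) * (f (L (hTheta k G D m) + 1) + 1)))) + 1

/-- `N = max {2 N₃, N₂ + N₃}`. -/
def NBall (N₂ N₃ : ℕ) : ℕ := max (2 * N₃) (N₂ + N₃)

/-- `M₂ = M₁ + 2 (N₃ + N)` with `M₁ = 3 N₂ + 4 N`. -/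
def M2 (N₂ N₃ : ℕ) : ℕ := (3 * N₂ + 4 * NBall N₂ N₃) + 2 * (N₃ + NBall N₂ N₃)

/-- `φ_{χ₀}(k, f) = Θ(4(k+1)² - 1, m ↦ m + f(m), L, Ψ, G, 4N²)` with `G(k) = E(M₂(k+1))` and
`Ψ`, `ψ`, `ξ` built from `χ₀`. -/
noncomputable def phiChi0 (a c : ℕ) (ℓ L Γ E C : ℕ → ℕ) (N₁ N₂ N₃ : ℕ)
    (k : ℕ) (f : ℕ → ℕ) : ℕ :=
  Theta (4 * (k + 1) ^ 2 - 1) (fun m => m + f m) L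
    (Psi c C (NBall N₂ N₃)
      (psi (NBall N₂ N₃) (xi a (mu a ℓ E N₂ N₃) (chi0 a c ℓ Γ E N₁ N₂ N₃))))
    (fun i => E (M2 N₂ N₃ * (i + 1))) (4 * NBall N₂ N₃ ^ 2)

/-- The rate of metastability `φ(k, f) = φ_{χ₀}(k, f^maj)`. -/
noncomputable def phi (a c : ℕ) (ℓ L Γ E C : ℕ → ℕ) (N₁ N₂ N₃ : ℕ)
    (k : ℕ) (f : ℕ → ℕ) : ℕ :=
  phiChi0 a c ℓ L Γ E C N₁ N₂ N₃ k (fmaj f)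

end MPPA

/-!
The iteration converges strongly to the projection of `u` onto the zeros of `T`; the proof makes each
step of the convergence argument quantitative and metastable, so that the bounds compose to `phi`.

* By Minty's theorem (`minty_of_graph`, `IsMaximalMonotone.inResolvent`) the resolvents are defined
  everywhere. They are nonexpansive, fix the zeros of `T`, and depend in a controlled way on their
  parameter.
* The iteration averages `z n` with points `w n` (`avgPoint`) for which `‖w (n + 1) - w n‖` exceeds
  `‖z (n + 1) - z n‖` by a null sequence. Suzuki's lemma (`suzuki_metastable`) therefore makes
  `w n - z n` small on long intervals, and with it the residuals of `z n` under the resolvents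
  (`resolvent_metastable`).
* The projection of `u` is replaced by an approximate one, found by finitely many improvements of the
  distance to `u` among approximate fixed points (`exists_approx_projection`). As the iterates are
  approximate fixed points, they satisfy its variational inequality (`projection_metastable`).
* For such a point `x` the numbers `‖z n - x‖²` obey a recursive inequality of the kind in Xu's lemma
  (`norm_sq_succ_le`). Over the interval in question the damping by `∏ (1 - λ_i)`, the residuals, the
  inner products and the errors contribute at most a quarter of the required precision each
  (`norm_sq_metastable`). Two iterates close to the same `x` are close to each other.

The counterfunctions are monotone throughout: a bound on `n` is then turned into a bound on `f n`, and
the witnesses into the stated functionals. For this reason `phi` starts from `fmaj f`.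
-/

open Filter Topology

namespace MPPA

/-! ### Minty's theorem -/

section Minty

/-- On a closed convex subset of `K × ℝ`, such as the epigraph of a convex function `φ`, the functional
`(p, r) ↦ r + ‖p‖² / 2` is strongly convex; if it is bounded below it attains its minimum, and it
grows quadratically away from the minimizer. Working with epigraphs lets `φ` take the value `+∞`. -/
theorem exists_strong_minimizer {K : Type*} [NormedAddCommGroup K] [InnerProductSpace ℝ K]
    [CompleteSpace K] {A : Set (K × ℝ)} (hconv : Convex ℝ A) (hclosed : IsClosed A)
    (hne : A.Nonempty) (hbdd : ∀ q ∈ A, 0 ≤ q.2 + ‖q.1‖ ^ 2 / 2) :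
    ∃ q₀ ∈ A, ∀ q ∈ A,
      q₀.2 + ‖q₀.1‖ ^ 2 / 2 + ‖q.1 - q₀.1‖ ^ 2 / 2 ≤ q.2 + ‖q.1‖ ^ 2 / 2 := by
  set val : K × ℝ → ℝ := fun q => q.2 + ‖q.1‖ ^ 2 / 2 with hval
  set m := sInf (val '' A) with hm
  have hbb : BddBelow (val '' A) := ⟨0, by rintro _ ⟨q, hq, rfl⟩; exact hbdd q hq⟩
  have hle : ∀ q ∈ A, m ≤ val q := fun q hq => csInf_le hbb ⟨q, hq, rfl⟩
  -- the value along a segment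
  have hseg : ∀ q q' : K × ℝ, ∀ t : ℝ, val ((1 - t) • q + t • q') =
      (1 - t) * val q + t * val q' - t * (1 - t) / 2 * ‖q'.1 - q.1‖ ^ 2 := by
    intro q q' t
    simp only [hval, Prod.fst_add, Prod.snd_add, Prod.smul_fst, Prod.smul_snd, smul_eq_mul]
    rw [norm_add_sq_real, norm_sub_sq_real, norm_smul, norm_smul, inner_smul_left,
      inner_smul_right, mul_pow, mul_pow, Real.norm_eq_abs, Real.norm_eq_abs, sq_abs, sq_abs,
      real_inner_comm]
    simp only [conj_trivial]
    ring
  have hmem : ∀ q ∈ A, ∀ q' ∈ A, ∀ t : ℝ, 0 ≤ t → t ≤ 1 → (1 - t) • q + t • q' ∈ A :=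
    fun q hq q' hq' t h0 h1 => hconv hq hq' (by linarith) h0 (by ring)
  have hdist : ∀ q ∈ A, ∀ q' ∈ A, ‖q'.1 - q.1‖ ^ 2 ≤ 4 * (val q - m) + 4 * (val q' - m) := by
    intro q hq q' hq'
    have h1 := hle _ (hmem q hq q' hq' (1 / 2) (by norm_num) (by norm_num))
    rw [hseg] at h1
    linarith
  have hex : ∀ n : ℕ, ∃ q ∈ A, val q < m + 1 / ((n : ℝ) + 1) := by
    intro n
    obtain ⟨_, ⟨q, hq, rfl⟩, h⟩ := exists_lt_of_csInf_lt (hne.image val)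
      (show sInf (val '' A) < m + 1 / ((n : ℝ) + 1) by
        have : (0 : ℝ) < 1 / ((n : ℝ) + 1) := by positivity
        linarith)
    exact ⟨q, hq, h⟩
  choose q hqA hqv using hex
  have hlim0 : Tendsto (fun n : ℕ => 1 / ((n : ℝ) + 1)) atTop (𝓝 0) :=
    tendsto_one_div_add_atTop_nhds_zero_nat
  have hvlim : Tendsto (fun n => val (q n)) atTop (𝓝 m) := by
    refine tendsto_of_tendsto_of_tendsto_of_le_of_le tendsto_const_nhds
      (by simpa using hlim0.const_add m) (fun n => hle _ (hqA n)) (fun n => (hqv n).le)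
  -- by the identity `hseg` at midpoints, minimizing sequences are Cauchy
  have hcauchy : CauchySeq fun n => (q n).1 := by
    refine cauchySeq_of_le_tendsto_0 (fun n : ℕ => Real.sqrt (8 * (1 / ((n : ℝ) + 1)))) ?_ ?_
    · intro i j n hi hj
      rw [dist_eq_norm]
      apply Real.le_sqrt_of_sq_le
      have h1 := hdist _ (hqA j) _ (hqA i)
      have h2 : 1 / ((i : ℝ) + 1) ≤ 1 / ((n : ℝ) + 1) := by gcongr
      have h3 : 1 / ((j : ℝ) + 1) ≤ 1 / ((n : ℝ) + 1) := by gcongr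
      linarith [hqv i, hqv j]
    · have := (hlim0.const_mul 8).sqrt
      simpa using this
  obtain ⟨p, hp⟩ := cauchySeq_tendsto_of_complete hcauchy
  have hr : Tendsto (fun n => (q n).2) atTop (𝓝 (m - ‖p‖ ^ 2 / 2)) := by
    have h := hvlim.sub ((hp.norm.pow 2).div_const 2)
    refine h.congr fun n => ?_
    simp [hval]
  have hq0 : (p, m - ‖p‖ ^ 2 / 2) ∈ A :=
    hclosed.mem_of_tendsto (hp.prodMk_nhds hr) (Eventually.of_forall hqA)
  refine ⟨_, hq0, fun q hq => ?_⟩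
  have hv0 : val (p, m - ‖p‖ ^ 2 / 2) = m := by simp [hval]
  -- divide the minimality along the segment by `t`, and let `t` tend to `0`
  have hstep : ∀ t : ℝ, 0 < t → t ≤ 1 → m + (1 - t) / 2 * ‖q.1 - p‖ ^ 2 ≤ val q := by
    intro t h0 h1
    have h := hle _ (hmem _ hq0 q hq t h0.le h1)
    rw [hseg, hv0] at h
    have : 0 ≤ t * (val q - (m + (1 - t) / 2 * ‖q.1 - p‖ ^ 2)) := by
      simp only at h
      linarith
    have := nonneg_of_mul_nonneg_right this h0
    linarith
  have hl : Tendsto (fun n : ℕ => m + (1 - 1 / ((n : ℝ) + 1)) / 2 * ‖q.1 - p‖ ^ 2) atTop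
      (𝓝 (m + (1 - 0) / 2 * ‖q.1 - p‖ ^ 2)) :=
    (((hlim0.const_sub 1).div_const 2).mul_const _).const_add m
  have hfin := le_of_tendsto hl (Eventually.of_forall fun n => hstep _ (by positivity) (by
    rw [div_le_one (by positivity)]
    linarith [(Nat.cast_nonneg n : (0 : ℝ) ≤ n)]))
  change val _ + _ ≤ val q
  rw [hv0]
  simp only
  linarith

variable {H : Type*} [NormedAddCommGroup H] [InnerProductSpace ℝ H] [CompleteSpace H]

/-- Minty's theorem, for the graph `G` of a maximal monotone operator: some `x` satisfies
`0 ∈ x + G x`. The set `A` in the proof is the epigraph of the Fitzpatrick function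
`(x, v) ↦ sup {⟪x, w⟫ + ⟪y, v⟫ - ⟪y, w⟫ | (y, w) ∈ G}`, which dominates `⟪x, v⟫` by maximality and
equals it on `G`. If `(x, v)` minimizes its sum with `(‖x‖² + ‖v‖²) / 2`, comparison with the points
of the graph shows that `(-v, -x) ∈ G` and `x + v = 0`. -/
theorem minty_of_graph {G : Set (H × H)} (hne : G.Nonempty)
    (hmono : ∀ p ∈ G, ∀ q ∈ G, 0 ≤ inner ℝ (p.1 - q.1) (p.2 - q.2))
    (hmax : ∀ p : H × H, (∀ q ∈ G, 0 ≤ inner ℝ (p.1 - q.1) (p.2 - q.2)) → p ∈ G) :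
    ∃ x, (x, -x) ∈ G := by
  set A : Set (WithLp 2 (H × H) × ℝ) := {q | ∀ g ∈ G,
    inner ℝ q.1.fst g.2 + inner ℝ g.1 q.1.snd - inner ℝ g.1 g.2 ≤ q.2} with hA
  have hfitz : ∀ q ∈ A, inner ℝ q.1.fst q.1.snd ≤ q.2 := by
    intro q hq
    by_contra! hlt
    have hmem : (q.1.fst, q.1.snd) ∈ G := by
      refine hmax _ fun g hg => ?_
      have h := hq g hg
      simp only [inner_sub_left, inner_sub_right]
      linarith
    have h := hq _ hmem
    simp only at h
    linarith
  have hclosed : IsClosed A := by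
    have : A = ⋂ g ∈ G, {q : WithLp 2 (H × H) × ℝ |
        inner ℝ q.1.fst g.2 + inner ℝ g.1 q.1.snd - inner ℝ g.1 g.2 ≤ q.2} := by
      ext q; simp [hA]
    rw [this]
    refine isClosed_biInter fun g _ => isClosed_le ?_ continuous_snd
    fun_prop
  have hconv : Convex ℝ A := by
    intro q hq q' hq' s t hs ht hst g hg
    have h1 := mul_le_mul_of_nonneg_left (hq g hg) hs
    have h2 := mul_le_mul_of_nonneg_left (hq' g hg) ht
    simp only [Prod.fst_add, Prod.snd_add, Prod.smul_fst, Prod.smul_snd, WithLp.add_fst,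
      WithLp.add_snd, WithLp.smul_fst, WithLp.smul_snd, inner_add_left, inner_add_right,
      inner_smul_left, inner_smul_right, conj_trivial, smul_eq_mul]
    have h3 : inner ℝ g.1 g.2 = (s + t) * inner ℝ g.1 g.2 := by rw [hst, one_mul]
    rw [h3]
    linarith
  have hgraph : ∀ g ∈ G, ((WithLp.toLp 2 g, inner ℝ g.1 g.2) : WithLp 2 (H × H) × ℝ) ∈ A := by
    intro g hg g' hg'
    have h := hmono g hg g' hg'
    simp only [inner_sub_left, inner_sub_right] at h
    change inner ℝ g.1 g'.2 + inner ℝ g'.1 g.2 - inner ℝ g'.1 g'.2 ≤ inner ℝ g.1 g.2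
    linarith
  have hsq : ∀ x v : H, 0 ≤ inner ℝ x v + (‖x‖ ^ 2 + ‖v‖ ^ 2) / 2 := by
    intro x v
    have := norm_add_sq_real x v
    linarith [sq_nonneg ‖x + v‖]
  obtain ⟨q₀, hq₀, hmin⟩ := exists_strong_minimizer hconv hclosed
    (let ⟨g, hg⟩ := hne; ⟨_, hgraph g hg⟩) (by
      intro q hq
      rw [WithLp.prod_norm_sq_eq_of_L2]
      linarith [hfitz q hq, hsq q.1.fst q.1.snd])
  set x := q₀.1.fst with hx
  set v := q₀.1.snd with hv
  have key : ∀ g ∈ G, ‖x + v‖ ^ 2 ≤ inner ℝ (-v - g.1) (-x - g.2) := by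
    intro g hg
    have h := hmin _ (hgraph g hg)
    rw [WithLp.prod_norm_sq_eq_of_L2, WithLp.prod_norm_sq_eq_of_L2,
      WithLp.prod_norm_sq_eq_of_L2] at h
    simp only [WithLp.sub_fst, WithLp.sub_snd] at h
    rw [← hx, ← hv, norm_sub_sq_real, norm_sub_sq_real] at h
    have h2 := hfitz _ hq₀
    rw [← hx, ← hv] at h2
    rw [norm_add_sq_real]
    simp only [inner_sub_left, inner_sub_right, inner_neg_left, inner_neg_right]
    rw [real_inner_comm x v, real_inner_comm g.2 v]
    change _ + _ + (‖g.1‖ ^ 2 - 2 * inner ℝ g.1 x + _ + (‖g.2‖ ^ 2 - 2 * inner ℝ g.2 v + _)) / 2 ≤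
      inner ℝ g.1 g.2 + (‖g.1‖ ^ 2 + ‖g.2‖ ^ 2) / 2 at h
    linarith
  have hmem : (-v, -x) ∈ G := hmax _ fun g hg => (sq_nonneg _).trans (key g hg)
  have h0 : x + v = 0 := by
    have h := key _ hmem
    simp only [sub_self, inner_zero_left] at h
    simpa using le_antisymm h (sq_nonneg _)
  refine ⟨x, ?_⟩
  rwa [← eq_neg_of_add_eq_zero_left h0] at hmem

end Minty

/-! ### Resolvents of maximal monotone operators -/

section Resolvent

variable {H : Type*} [NormedAddCommGroup H] [InnerProductSpace ℝ H] {T : H → Set H}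

/-- Maximality in terms of points: a pair in monotone relation to the whole graph belongs to it. -/
theorem IsMaximalMonotone.mem (hT : IsMaximalMonotone T) {x v : H}
    (h : ∀ y, ∀ w ∈ T y, 0 ≤ inner ℝ (x - y) (v - w)) : v ∈ T x := by
  have hT' : (fun y => T y ∪ {w | y = x ∧ w = v}) = T := by
    refine hT.2 _ ?_ fun y w hw => Or.inl hw
    rintro y y' w (hw | ⟨rfl, rfl⟩) w' (hw' | ⟨rfl, rfl⟩)
    · exact hT.1 y y' w hw w' hw'
    · have := h y w hw
      rwa [← neg_sub y y', ← neg_sub w w', inner_neg_neg] at this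
    · exact h y' w' hw'
    · simp
  rw [← hT']
  exact Or.inr ⟨rfl, rfl⟩

theorem resolvent_of_mem_zeros (hT : IsMonotoneOperator T) {s : H} (hs : s ∈ zeros T)
    {c : ℝ} (hc : 0 < c) : resolvent T c s = s :=
  resolvent_eq hT hc ⟨0, hs, by simp⟩

variable [CompleteSpace H]

/-- The resolvent function takes a genuine value everywhere, so its default value never occurs. -/
theorem IsMaximalMonotone.inResolvent (hT : IsMaximalMonotone T) (hS : (zeros T).Nonempty)
    {c : ℝ} (hc : 0 < c) (x : H) : InResolvent T c x (resolvent T c x) := by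
  have hex : ∃ y, InResolvent T c x y := by
    obtain ⟨s, hs⟩ := hS
    set G : Set (H × H) := {p | ∃ v ∈ T p.1, p.2 = c • v - x} with hG
    have hmono : ∀ p ∈ G, ∀ q ∈ G, 0 ≤ inner ℝ (p.1 - q.1) (p.2 - q.2) := by
      rintro ⟨y, _⟩ ⟨v, hv, rfl⟩ ⟨y', _⟩ ⟨v', hv', rfl⟩
      simp only [sub_sub_sub_cancel_right, ← smul_sub, inner_smul_right]
      exact mul_nonneg hc.le (hT.1 y y' v hv v' hv')
    have hmax : ∀ p : H × H, (∀ q ∈ G, 0 ≤ inner ℝ (p.1 - q.1) (p.2 - q.2)) → p ∈ G := by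
      rintro ⟨y, w⟩ h
      refine ⟨c⁻¹ • (w + x), hT.mem fun y' v' hv' => ?_, ?_⟩
      · have h1 := h (y', c • v' - x) ⟨v', hv', rfl⟩
        have h2 : c⁻¹ • (w + x) - v' = c⁻¹ • (w - (c • v' - x)) := by
          simp only [smul_sub, smul_add, smul_smul, inv_mul_cancel₀ hc.ne', one_smul]
          abel
        simp only at h1 ⊢
        rw [h2, inner_smul_right]
        exact mul_nonneg (inv_nonneg.2 hc.le) h1
      · simp [smul_smul, mul_inv_cancel₀ hc.ne']
    obtain ⟨y, v, hv, h⟩ := minty_of_graph (G := G) ⟨(s, c • (0 : H) - x), 0, hs, rfl⟩ hmono hmax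
    refine ⟨y, v, hv, ?_⟩
    rwa [eq_sub_iff_add_eq, neg_add_eq_iff_eq_add] at h
  obtain ⟨y, hy⟩ := hex
  rwa [resolvent_eq hT.1 hc hy]

theorem IsMaximalMonotone.norm_resolvent_sub_le (hT : IsMaximalMonotone T)
    (hS : (zeros T).Nonempty) {c : ℝ} (hc : 0 < c) (x y : H) :
    ‖resolvent T c x - resolvent T c y‖ ≤ ‖x - y‖ := by
  obtain ⟨v, hv, hx⟩ := hT.inResolvent hS hc x
  obtain ⟨w, hw, hy⟩ := hT.inResolvent hS hc y
  set p := resolvent T c x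
  set q := resolvent T c y
  have h1 := hT.1 p q v hv w hw
  have h2 : x - y = (p - q) + c • (v - w) := by
    rw [hx, hy, smul_sub]; abel
  refine (sq_le_sq₀ (norm_nonneg _) (norm_nonneg _)).1 ?_
  rw [h2, norm_add_sq_real, inner_smul_right]
  nlinarith [sq_nonneg ‖c • (v - w)‖, mul_nonneg hc.le h1]

/-- Dependence of the resolvent on its parameter. It follows from the resolvent identity
`J_{c'} x' = J_c ((c / c') x' + (1 - c / c') J_{c'} x')`. -/
theorem IsMaximalMonotone.norm_resolvent_sub_resolvent_le (hT : IsMaximalMonotone T)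
    (hS : (zeros T).Nonempty) {c c' : ℝ} (hc : 0 < c) (hc' : 0 < c') (x x' : H) :
    ‖resolvent T c' x' - resolvent T c x‖ ≤
      ‖x' - x‖ + |c / c' - 1| * ‖x' - resolvent T c' x'‖ := by
  obtain ⟨v, hv, hx⟩ := hT.inResolvent hS hc' x'
  set y := resolvent T c' x' with hy
  have h1 : resolvent T c (y + c • v) = y := resolvent_eq hT.1 hc ⟨v, hv, rfl⟩
  have h2 : y + c • v - x = (x' - x) + (c / c' - 1) • (x' - y) := by
    have : x' - y = c' • v := by rw [hx]; abel
    rw [this, smul_smul, sub_mul, div_mul_cancel₀ _ hc'.ne', one_mul, sub_smul, ← this]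
    abel
  calc ‖y - resolvent T c x‖ = ‖resolvent T c (y + c • v) - resolvent T c x‖ := by rw [h1]
    _ ≤ ‖y + c • v - x‖ := hT.norm_resolvent_sub_le hS hc _ _
    _ ≤ _ := by
      rw [h2, ← Real.norm_eq_abs, ← norm_smul]
      exact norm_add_le _ _

theorem IsMaximalMonotone.norm_sub_resolvent_le_two_mul (hT : IsMaximalMonotone T)
    (hS : (zeros T).Nonempty) {c c' : ℝ} (hc : 0 < c) (hcc' : c ≤ c') (x : H) :
    ‖resolvent T c x - x‖ ≤ 2 * ‖resolvent T c' x - x‖ := by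
  have hc' := hc.trans_le hcc'
  have h := hT.norm_resolvent_sub_resolvent_le hS hc hc' x x
  have h1 : |c / c' - 1| ≤ 1 := by
    rw [abs_le]
    have := (div_le_one hc').2 hcc'
    have : 0 < c / c' := by positivity
    constructor <;> linarith
  have h2 := norm_sub_le_norm_sub_add_norm_sub (resolvent T c x) (resolvent T c' x) x
  rw [sub_self, norm_zero, zero_add, norm_sub_rev] at h
  rw [norm_sub_rev x] at h
  have := mul_le_mul_of_nonneg_right h1 (norm_nonneg (resolvent T c' x - x))
  linarith

theorem IsMaximalMonotone.norm_sub_resolvent_le_div_mul (hT : IsMaximalMonotone T)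
    (hS : (zeros T).Nonempty) {c c' : ℝ} (hc : 0 < c) (hcc' : c ≤ c') (x : H) :
    ‖resolvent T c' x - x‖ ≤ c' / c * ‖resolvent T c x - x‖ := by
  have hc' := hc.trans_le hcc'
  have h := hT.norm_resolvent_sub_resolvent_le hS hc' hc x x
  have h1 : |c' / c - 1| = c' / c - 1 :=
    abs_of_nonneg (sub_nonneg.2 ((one_le_div hc).2 hcc'))
  have h2 := norm_sub_le_norm_sub_add_norm_sub (resolvent T c' x) (resolvent T c x) x
  rw [sub_self, norm_zero, zero_add, norm_sub_rev, norm_sub_rev x, h1] at h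
  linarith

end Resolvent

/-! ### Suzuki's lemma -/

section Suzuki

/-- A quantitative limit superior. For a sequence with values in `[0, P ε]`, some multiple `p` of `ε`
bounds the sequence on a long interval and is attained up to `ε` at distance `t` from its left end.
The levels `P ε, (P - 1) ε, …` are tried in turn: if no value within `ε` of the current level is met
in the search interval, then the next lower level is a bound on that interval. `rDown` provides the
lengths of these intervals, counted from the last one. -/
theorem exists_level {x : ℕ → ℝ} {M t P : ℕ} {ε : ℝ} {f : ℕ → ℕ} (hf : Monotone f) (hP : 0 < P)
    (hx0 : ∀ i, 0 ≤ x i) (hxP : ∀ i, x i ≤ P * ε) :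
    ∃ n, M ≤ n ∧ n ≤ M + (P - 1) * t + rDown f M t P P ∧ ∃ p, p - ε ≤ x (n + t) ∧
      ∀ i, n ≤ i → i ≤ n + t + f (n + t) → x i ≤ p := by
  have hmono : Monotone (rDown f M t P) := monotone_nat_of_le_succ fun j => by
    simp only [rDown]; omega
  have main : ∀ j, j + 1 ≤ P → (∀ i, M + (P - (j + 1)) * t ≤ i →
      i ≤ M + (P - (j + 1)) * t + rDown f M t P (j + 1) → x i ≤ ((j + 1 : ℕ) : ℝ) * ε) →
      ∃ n, M ≤ n ∧ n ≤ M + (P - 1) * t + rDown f M t P P ∧ ∃ p, p - ε ≤ x (n + t) ∧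
        ∀ i, n ≤ i → i ≤ n + t + f (n + t) → x i ≤ p := by
    intro j
    induction j with
    | zero =>
      intro _ h
      refine ⟨M + (P - 1) * t, by omega, by omega, ((0 + 1 : ℕ) : ℝ) * ε, ?_, fun i h1 h2 =>
        h i (by omega) (h2.trans ?_)⟩
      · simpa using hx0 _
      · have e : P * t = (P - 1) * t + t := by
          rw [← Nat.succ_mul]; congr 1; omega
        simp only [rDown, Nat.sub_zero, add_zero, zero_add, e]
        rw [add_assoc M, ← add_assoc]
        omega
    | succ j ih =>
      intro hj h
      have e : (P - (j + 1)) * t = (P - (j + 1 + 1)) * t + t := by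
        rw [← Nat.succ_mul]; congr 1; omega
      by_cases hq : ∃ q, M + (P - (j + 1)) * t ≤ q ∧
          q ≤ M + (P - (j + 1)) * t + rDown f M t P (j + 1) ∧ ((j + 1 : ℕ) : ℝ) * ε ≤ x q
      · obtain ⟨q, h1, h2, h3⟩ := hq
        have hqt : q - t + t = q := Nat.sub_add_cancel (by omega)
        have h4 : (P - (j + 1 + 1)) * t ≤ (P - 1) * t := Nat.mul_le_mul_right _ (by omega)
        have h5 := hmono (show j + 1 ≤ P by omega)
        refine ⟨q - t, by omega, by omega, ((j + 1 + 1 : ℕ) : ℝ) * ε, ?_, fun i h6 h7 =>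
          h i (by omega) ?_⟩
        · rw [hqt]; push_cast at h3 ⊢; linarith
        · rw [hqt] at h7
          have h8 := hf h2
          rw [rDown]
          omega
      · push Not at hq
        exact ih (by omega) fun i h1 h2 => (hq i h1 h2).le
  obtain ⟨j, rfl⟩ : ∃ j, P = j + 1 := ⟨P - 1, by omega⟩
  exact main j le_rfl fun i _ _ => hxP i

variable {H : Type*} [NormedAddCommGroup H] [NormedSpace ℝ H]

/-- The combinatorial core of Suzuki's lemma. If `‖w i - z i‖ ≤ p` up to the index `q`, with
approximate equality at `q`, then going back `j` steps the distance from `w q` to `z (q - j)` grows to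
at least `(1 + j / a) p`, up to a multiple of `ε`. In the statement `A` is the sum of `1 - γ i` over
`q - j ≤ i < q`. -/
theorem suzuki_lower_bound {z w : ℕ → H} {γ : ℕ → ℝ} {a p ε : ℝ} {n q : ℕ}
    (ha : 1 ≤ a) (hε : 0 ≤ ε)
    (hγ : ∀ i, 1 / a ≤ γ i ∧ γ i ≤ 1 - 1 / a)
    (hz : ∀ i, z (i + 1) = γ i • z i + (1 - γ i) • w i)
    (hw : ∀ i, n ≤ i → ‖w (i + 1) - w i‖ ≤ ‖z (i + 1) - z i‖ + ε)
    (hx : ∀ i, n ≤ i → i ≤ q → ‖w i - z i‖ ≤ p) (hq : p - ε ≤ ‖w q - z q‖) (j : ℕ) :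
    ∀ m, m + j = q → n ≤ m → ∃ A : ℝ, (j : ℝ) / a ≤ A ∧ ‖w q - w m‖ ≤ A * p + j * ε ∧
      (1 + A) * p - a ^ j * (1 + (j : ℝ) ^ 2) * ε ≤ ‖w q - z m‖ := by
  have ha0 : 0 < a := by linarith
  induction j with
  | zero =>
    rintro m rfl -
    exact ⟨0, by simp, by simp, by simpa using hq⟩
  | succ j ih =>
    intro m hm hnm
    obtain ⟨A, hA, h1, h2⟩ := ih (m + 1) (by omega) (by omega)
    obtain ⟨hg1, hg2⟩ := hγ m
    have hg0 : 0 < γ m := lt_of_lt_of_le (by positivity) hg1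
    have hg3 : 0 ≤ 1 - γ m := by
      have : 0 ≤ 1 / a := by positivity
      linarith
    have hzz : ‖z (m + 1) - z m‖ = (1 - γ m) * ‖w m - z m‖ := by
      have : z (m + 1) - z m = (1 - γ m) • (w m - z m) := by
        rw [hz]; module
      rw [this, norm_smul, Real.norm_of_nonneg hg3]
    have h3 : ‖w q - w m‖ ≤ (1 - γ m + A) * p + (j + 1 : ℕ) * ε := by
      have h4 := norm_sub_le_norm_sub_add_norm_sub (w q) (w (m + 1)) (w m)
      have h5 := hw m hnm
      have h6 := mul_le_mul_of_nonneg_left (hx m hnm (by omega)) hg3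
      push_cast
      linarith
    refine ⟨1 - γ m + A, ?_, h3, ?_⟩
    · push_cast
      rw [add_div]
      linarith
    · have h4 : ‖w q - z (m + 1)‖ ≤ γ m * ‖w q - z m‖ + (1 - γ m) * ‖w q - w m‖ := by
        have : w q - z (m + 1) = γ m • (w q - z m) + (1 - γ m) • (w q - w m) := by
          rw [hz]; module
        rw [this]
        refine (norm_add_le _ _).trans_eq ?_
        rw [norm_smul, norm_smul, Real.norm_of_nonneg hg3, Real.norm_of_nonneg hg0.le]
      have h5 := mul_le_mul_of_nonneg_left h3 hg3
      have haj : (1 : ℝ) ≤ a ^ j := one_le_pow₀ ha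
      have hga : 1 ≤ γ m * a := by
        rwa [div_le_iff₀ ha0] at hg1
      -- the error terms
      have h6 : a ^ j * (1 + (j : ℝ) ^ 2) + (1 - γ m) * (j + 1) ≤
          γ m * (a ^ (j + 1) * (1 + ((j : ℝ) + 1) ^ 2)) := by
        have hj : (0 : ℝ) ≤ j := Nat.cast_nonneg j
        calc a ^ j * (1 + (j : ℝ) ^ 2) + (1 - γ m) * (j + 1)
            ≤ a ^ j * (1 + (j : ℝ) ^ 2) + a ^ j * (j + 1) := by
              have := mul_le_mul_of_nonneg_right (show 1 - γ m ≤ a ^ j by linarith)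
                (by positivity : (0 : ℝ) ≤ j + 1)
              linarith
          _ ≤ a ^ j * (1 + ((j : ℝ) + 1) ^ 2) := by
              rw [← mul_add]
              refine mul_le_mul_of_nonneg_left ?_ (by positivity)
              linarith
          _ ≤ (γ m * a) * (a ^ j * (1 + ((j : ℝ) + 1) ^ 2)) :=
              le_mul_of_one_le_left (by positivity) hga
          _ = _ := by ring
      have h7 := mul_le_mul_of_nonneg_right h6 hε
      push_cast at h5 ⊢
      refine le_of_mul_le_mul_left ?_ hg0
      linarith

/-- Suzuki's lemma with a rate of metastability. If the level `p` given by `exists_level` exceeded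
`1 / (k + 1)`, then `suzuki_lower_bound` over `t` steps would contradict the bound `2 K` on
`‖w i - z j‖`. -/
theorem suzuki_metastable {z w : ℕ → H} {γ : ℕ → ℝ} {a K : ℕ} {ν : ℕ → ℕ} (ha : 0 < a)
    (hK : 0 < K) (hγ : ∀ i, 1 / (a : ℝ) ≤ γ i ∧ γ i ≤ 1 - 1 / (a : ℝ))
    (hz : ∀ i, z (i + 1) = γ i • z i + (1 - γ i) • w i)
    (hzK : ∀ i, ‖z i‖ ≤ K) (hwK : ∀ i, ‖w i‖ ≤ K)
    (hν : ∀ k n : ℕ, ν k ≤ n → ‖w (n + 1) - w n‖ ≤ ‖z (n + 1) - z n‖ + 1 / ((k : ℝ) + 1))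
    (k : ℕ) {f : ℕ → ℕ} (hf : Monotone f) :
    ∃ n ≤ chiTilde k f a ν K, ∀ i, n ≤ i → i ≤ n + f n → ‖w i - z i‖ ≤ 1 / ((k : ℝ) + 1) := by
  set t := max (2 * K * a * (k + 1)) 1 with ht
  have ht1 : 1 ≤ t := le_max_right _ _
  have ha1 : (1 : ℝ) ≤ a := by exact_mod_cast ha
  have ha0 : (0 : ℝ) < a := by linarith
  have hρ : 0 < RSuzuki a k t := by unfold RSuzuki; positivity
  set ρ := RSuzuki a k t with hρdef
  have hρ1 : ρ - 1 + 1 = ρ := Nat.sub_add_cancel hρ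
  set M := max a (max a (ν (ρ - 1))) with hM
  have hρ0 : (0 : ℝ) < ρ := by exact_mod_cast hρ
  have h2K : ∀ i j, ‖w i - z j‖ ≤ 2 * K := fun i j =>
    (norm_sub_le _ _).trans (by linarith [hzK j, hwK i])
  obtain ⟨n, hn1, hn2, p, hp1, hp2⟩ := exists_level (x := fun i => ‖w i - z i‖) (M := M) (t := t)
    (P := 2 * K * ρ) (ε := 1 / ρ) (f := fun m => t + f m)
    (fun i j hij => Nat.add_le_add_left (hf hij) _) (by positivity) (fun i => norm_nonneg _)
    (fun i => by
      refine (h2K i i).trans_eq ?_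
      push_cast
      field_simp)
  have hp0 : 0 ≤ p := (norm_nonneg _).trans (hp2 n le_rfl (by omega))
  have hcast : ((ρ - 1 : ℕ) : ℝ) + 1 = ρ := by exact_mod_cast hρ1
  obtain ⟨A, hA, -, hA2⟩ := suzuki_lower_bound (z := z) (w := w) (n := n) (q := n + t)
    (ε := 1 / (ρ : ℝ)) ha1 (by positivity) hγ hz
    (fun i hi => by
      have h := hν (ρ - 1) i (((le_max_right _ _).trans (le_max_right _ _)).trans (hn1.trans hi))
      rwa [hcast] at h)
    (fun i h1 h2 => hp2 i h1 (by omega)) hp1 t n rfl le_rfl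
  have hk : (0 : ℝ) < (k : ℝ) + 1 := by positivity
  have herr : (a : ℝ) ^ t * (1 + (t : ℝ) ^ 2) * (1 / ρ) ≤ 1 / ((k : ℝ) + 1) := by
    have ht1' : (1 : ℝ) ≤ t := by exact_mod_cast ht1
    have hρe : (ρ : ℝ) = t * (2 * t + 1) * a ^ t * (k + 1) := by
      rw [hρdef, RSuzuki]; push_cast; ring
    rw [mul_one_div, hρe, div_le_div_iff₀ (by positivity) hk, one_mul]
    have : 1 + (t : ℝ) ^ 2 ≤ t * (2 * t + 1) := by nlinarith
    calc (a : ℝ) ^ t * (1 + (t : ℝ) ^ 2) * (k + 1) ≤ a ^ t * (t * (2 * t + 1)) * (k + 1) := by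
          gcongr
      _ = _ := by ring
  have hA3 : 2 * K * ((k : ℝ) + 1) ≤ A := by
    refine le_trans ?_ hA
    rw [le_div_iff₀ ha0]
    have : 2 * K * a * (k + 1) ≤ t := le_max_left _ _
    have : (2 * K * a * (k + 1) : ℝ) ≤ t := by exact_mod_cast this
    linarith
  have hpk : p ≤ 1 / ((k : ℝ) + 1) := by
    have h1 := mul_le_mul_of_nonneg_right hA3 hp0
    have h2 := h2K (n + t) n
    have h3 : (1 + 2 * K * ((k : ℝ) + 1)) * p ≤
        (1 + 2 * K * ((k : ℝ) + 1)) * (1 / ((k : ℝ) + 1)) := by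
      have : (1 + 2 * K * ((k : ℝ) + 1)) * (1 / ((k : ℝ) + 1)) = 1 / ((k : ℝ) + 1) + 2 * K := by
        field_simp
      linarith
    exact le_of_mul_le_mul_left h3 (by positivity)
  refine ⟨n, ?_, fun i h1 h2 => (hp2 i h1 ?_).trans hpk⟩
  · rw [chiTilde, phiSuzuki, theta, ← ht, ← hρdef, hρ1]
    exact hn2
  · have := hf (Nat.le_add_right n t)
    omega

end Suzuki

/-! ### Monotonicity of the bounding functionals -/

section Functionals

theorem rDown_le_rDown {f f' : ℕ → ℕ} (hf : Monotone f) (hff' : ∀ n, f n ≤ f' n)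
    {M M' t t' P : ℕ} (hM : M ≤ M') (ht : t ≤ t') (d j : ℕ) :
    rDown f M t P j ≤ rDown f' M' t' (P + d) (j + d) := by
  induction j with
  | zero => exact Nat.zero_le _
  | succ j ih =>
    rw [Nat.succ_add, rDown, rDown, Nat.add_sub_add_right]
    have h1 : M + (P - j) * t + rDown f M t P j ≤
        M' + (P - j) * t' + rDown f' M' t' (P + d) (j + d) := by gcongr
    have h2 := (hf h1).trans (hff' _)
    omega

/-- Here `r_0` for the smaller number of levels is compared with `r_0` for the larger one: by
`rDown_le_rDown` each `r_i` increases with the number of levels. -/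
theorem theta_le_theta {f f' : ℕ → ℕ} (hf : Monotone f) (hff' : ∀ n, f n ≤ f' n)
    {k k' M M' t t' : ℕ} (hk : k ≤ k') (hM : M ≤ M') (ht : t ≤ t') (K : ℕ) :
    theta k M t K f ≤ theta k' M' t' K f' := by
  have hP : K * (k + 1) ≤ K * (k' + 1) := by gcongr
  obtain ⟨d, hd⟩ := Nat.exists_eq_add_of_le hP
  unfold theta
  have h1 := rDown_le_rDown hf hff' hM ht (P := K * (k + 1)) d (K * (k + 1))
  rw [← hd] at h1
  gcongr

theorem chiTilde_le_chiTilde {f f' : ℕ → ℕ} (hf : Monotone f) (hff' : ∀ n, f n ≤ f' n)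
    {k k' : ℕ} (hk : k ≤ k') {a : ℕ} (ha : 0 < a) {ν : ℕ → ℕ} (hν : Monotone ν) (K : ℕ) :
    chiTilde k f a ν K ≤ chiTilde k' f' a ν K := by
  unfold chiTilde phiSuzuki
  have ht : max (2 * K * a * (k + 1)) 1 ≤ max (2 * K * a * (k' + 1)) 1 := by gcongr
  have hR : RSuzuki a k (max (2 * K * a * (k + 1)) 1) - 1 ≤
      RSuzuki a k' (max (2 * K * a * (k' + 1)) 1) - 1 := by
    unfold RSuzuki
    gcongr
  refine theta_le_theta (fun i j hij => Nat.add_le_add_left (hf hij) _)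
    (fun n => Nat.add_le_add ht (hff' n)) hR ?_ ht _
  have := hν hR
  gcongr

theorem nu_mono {a c N₁ N₂ N₃ : ℕ} {ℓ Γ E : ℕ → ℕ} (hℓ : Monotone ℓ) (hΓ : Monotone Γ)
    (hE : Monotone E) : Monotone (nu a c ℓ Γ E N₁ N₂ N₃) := by
  intro k k' hk
  unfold nu
  refine max_le_max (hΓ (by gcongr)) (max_le_max (hℓ (by gcongr)) ?_)
  exact Nat.add_le_add_right (hE (by gcongr)) _

theorem mu_mono {a N₂ N₃ : ℕ} {ℓ E : ℕ → ℕ} (hℓ : Monotone ℓ) (hE : Monotone E) :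
    Monotone (mu a ℓ E N₂ N₃) := by
  intro k k' hk
  unfold mu
  exact max_le_max (hℓ (by gcongr)) (Nat.add_le_add_right (hE (by gcongr)) _)

theorem xi_mono {a : ℕ} {μ : ℕ → ℕ} (hμ : Monotone μ) {χ : ℕ → (ℕ → ℕ) → ℕ}
    (hχ : ∀ {k k' : ℕ} {f f' : ℕ → ℕ}, k ≤ k' → Monotone f → (∀ n, f n ≤ f' n) →
      χ k f ≤ χ k' f') {f : ℕ → ℕ} (hf : Monotone f) : Monotone fun k => xi a μ χ k f := by
  intro k k' hk
  have h1 : μ (2 * k + 1) ≤ μ (2 * k' + 1) := hμ (by omega)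
  refine max_le_max h1 (hχ (by gcongr) ?_ ?_)
  · intro i j hij
    exact Nat.add_le_add_left (hf (max_le_max le_rfl hij)) _
  · intro n
    exact Nat.add_le_add h1 (hf (max_le_max h1 le_rfl))

end Functionals

/-! ### Approximate projections onto the fixed point set -/

section Projection

/-- Among the approximate fixed points, some `x` almost minimizes the distance to `u`; here the accuracy
of `x` as a fixed point depends, through the arbitrary function `F`, on the accuracy of the points with
which it is compared. Otherwise, from the fixed point `s` on, `‖u - x‖²` could be decreased `r` times
by more than `ε`. -/
theorem exists_approx_minimizer {H : Type*} [NormedAddCommGroup H] {J : H → H} {s u : H}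
    (hs : J s = s) {N ε : ℝ} (hN : 0 ≤ N) (F : ℕ → ℕ) {r : ℕ} (hr : 0 < r)
    (hrε : ‖u - s‖ ^ 2 ≤ r * ε) :
    ∃ i < r, ∃ x, ‖x - s‖ ≤ N ∧ ‖J x - x‖ ≤ 1 / ((F^[i + 1] 0 : ℕ) + 1 : ℝ) ∧
      ∀ y, ‖y - s‖ ≤ N → ‖J y - y‖ ≤ 1 / ((F^[i] 0 : ℕ) + 1 : ℝ) →
        ‖u - x‖ ^ 2 ≤ ‖u - y‖ ^ 2 + ε := by
  by_contra! hcon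
  have main : ∀ m, m < r → ∃ x, ‖x - s‖ ≤ N ∧ ‖J x - x‖ ≤ 1 / ((F^[r - m] 0 : ℕ) + 1 : ℝ) ∧
      ‖u - x‖ ^ 2 + m * ε ≤ ‖u - s‖ ^ 2 := by
    intro m
    induction m with
    | zero =>
      intro _
      refine ⟨s, by simpa using hN, ?_, by simp⟩
      rw [hs, sub_self, norm_zero]
      positivity
    | succ m ih =>
      intro hm
      obtain ⟨x, hx, hJx, hux⟩ := ih (by omega)
      have e : r - m = (r - (m + 1)) + 1 := by omega
      rw [e] at hJx
      obtain ⟨y, hy, hJy, huy⟩ := hcon (r - (m + 1)) (by omega) x hx hJx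
      refine ⟨y, hy, hJy, ?_⟩
      push_cast
      linarith
  obtain ⟨r, rfl⟩ : ∃ r', r = r' + 1 := ⟨r - 1, by omega⟩
  obtain ⟨x, hx, hJx, hux⟩ := main r (by omega)
  rw [Nat.add_sub_cancel_left] at hJx
  obtain ⟨y, -, -, huy⟩ := hcon 0 (by omega) x hx hJx
  push_cast at hrε
  linarith [sq_nonneg ‖u - y‖]

variable {H : Type*} [NormedAddCommGroup H] [InnerProductSpace ℝ H]

/-- The points of a segment between two approximate fixed points of a nonexpansive map are
approximate fixed points. -/
theorem norm_sq_segment_sub_le {J : H → H} (hJ : ∀ x y, ‖J x - J y‖ ≤ ‖x - y‖) {x y : H}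
    {η t : ℝ} (ht0 : 0 ≤ t) (ht1 : t ≤ 1) (hx : ‖J x - x‖ ≤ η) (hy : ‖J y - y‖ ≤ η) :
    ‖J ((1 - t) • x + t • y) - ((1 - t) • x + t • y)‖ ^ 2 ≤ η * ‖x - y‖ + η ^ 2 := by
  set w := (1 - t) • x + t • y with hw
  set d := ‖x - y‖ with hd
  have hη : 0 ≤ η := (norm_nonneg _).trans hx
  have hd0 : 0 ≤ d := norm_nonneg _
  have h1 : ‖J w - x‖ ≤ t * d + η := by
    have e : w - x = t • (y - x) := by rw [hw]; module
    have h := norm_sub_le_norm_sub_add_norm_sub (J w) (J x) x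
    have h' := hJ w x
    rw [e, norm_smul, Real.norm_of_nonneg ht0, norm_sub_rev y x] at h'
    linarith
  have h2 : ‖J w - y‖ ≤ (1 - t) * d + η := by
    have e : w - y = (1 - t) • (x - y) := by rw [hw]; module
    have h := norm_sub_le_norm_sub_add_norm_sub (J w) (J y) y
    have h' := hJ w y
    rw [e, norm_smul, Real.norm_of_nonneg (sub_nonneg.2 ht1)] at h'
    linarith
  have h3 : ‖J w - w‖ ^ 2 =
      (1 - t) * ‖J w - x‖ ^ 2 + t * ‖J w - y‖ ^ 2 - t * (1 - t) * d ^ 2 := by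
    have e1 : J w - w = (1 - t) • (J w - x) + t • (J w - y) := by rw [hw]; module
    have e2 : x - y = (J w - y) - (J w - x) := by abel
    rw [hd, e1, e2, norm_add_sq_real, norm_sub_sq_real (J w - y) (J w - x), norm_smul, norm_smul,
      inner_smul_left, inner_smul_right, mul_pow, mul_pow, Real.norm_eq_abs, Real.norm_eq_abs, sq_abs,
      sq_abs, real_inner_comm (J w - x)]
    simp only [conj_trivial]
    ring
  have h4 := mul_le_mul_of_nonneg_left (pow_le_pow_left₀ (norm_nonneg _) h1 2)
    (sub_nonneg.2 ht1)
  have h5 := mul_le_mul_of_nonneg_left (pow_le_pow_left₀ (norm_nonneg _) h2 2) ht0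
  have h6 : 0 ≤ η * d * (1 - 2 * t) ^ 2 := by positivity
  rw [h3]
  nlinarith

theorem le_check {N : ℕ} (hN : 0 < N) (g : ℕ → ℕ) (m : ℕ) : m ≤ check N g m := by
  refine le_trans ?_ (le_max_right _ _)
  nlinarith

/-- An approximate projection `x` of `u` onto the fixed point set of a nonexpansive map, given by its
variational inequality. It replaces the projection in the convergence proof and is obtained without
weak compactness: compare the approximate minimizer `x` with the points of the segment from `x`
to `y`. -/
theorem exists_approx_projection {J : H → H} (hJ : ∀ x y, ‖J x - J y‖ ≤ ‖x - y‖) {s u : H}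
    (hs : J s = s) {N : ℕ} (hN : 0 < N) (hu : 2 * ‖u - s‖ ≤ N) (k : ℕ) (g : ℕ → ℕ) :
    ∃ j ≤ (check N g)^[N ^ 4 * (k + 1) ^ 2] 0, ∃ x, ‖x - s‖ ≤ N ∧
      ‖J x - x‖ ≤ 1 / ((g (24 * N * (j + 1) ^ 2) : ℝ) + 1) ∧
      ∀ y, ‖y - s‖ ≤ N → ‖J y - y‖ ≤ 1 / (((24 * N * (j + 1) ^ 2 : ℕ) : ℝ) + 1) →
        inner ℝ (u - x) (y - x) ≤ 1 / ((k : ℝ) + 1) := by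
  have hN1 : (1 : ℝ) ≤ N := by exact_mod_cast hN
  have hk : (1 : ℝ) ≤ (k : ℝ) + 1 := by
    have : (0 : ℝ) ≤ k := Nat.cast_nonneg k
    linarith
  set R := N ^ 4 * (k + 1) ^ 2 with hR
  -- the precision is chosen so that `R` steps exhaust `‖u - s‖² ≤ N² / 4`
  obtain ⟨i, hi, x, hx, hJx, hmin⟩ := exists_approx_minimizer (u := u) hs
    (N := N) (ε := 1 / (4 * N ^ 2 * ((k : ℝ) + 1) ^ 2)) (by positivity) (check N g) (r := R)
    (by positivity) (by
      rw [hR]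
      push_cast
      have h1 : (N : ℝ) ^ 4 * (k + 1) ^ 2 * (1 / (4 * N ^ 2 * (k + 1) ^ 2)) = (N / 2) ^ 2 := by
        field_simp
        ring
      rw [h1]
      exact pow_le_pow_left₀ (norm_nonneg _) (by linarith) 2)
  set j := (check N g)^[i] 0 with hj
  have hjR : j ≤ (check N g)^[R] 0 :=
    Function.monotone_iterate_of_id_le (fun m => le_check hN g m) hi.le 0
  rw [Function.iterate_succ_apply', ← hj] at hJx
  refine ⟨j, hjR, x, hx, hJx.trans ?_, fun y hy hJy => ?_⟩
  · have : g (24 * N * (j + 1) ^ 2) ≤ check N g j := le_max_left _ _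
    gcongr
  · set η : ℝ := 1 / (((24 * N * (j + 1) ^ 2 : ℕ) : ℝ) + 1) with hη
    have hη0 : 0 ≤ η := by positivity
    have hJx' : ‖J x - x‖ ≤ η := by
      refine hJx.trans ?_
      have : 24 * N * (j + 1) ^ 2 ≤ check N g j := le_max_right _ _
      rw [hη]
      gcongr
    have hxy : ‖x - y‖ ≤ 2 * N := by
      have := norm_sub_le_norm_sub_add_norm_sub x s y
      rw [norm_sub_rev s y] at this
      linarith
    -- this `t` minimizes the bound `2 N² t + ε / (2 t)`, whose value is then `1 / (k + 1)`
    set t : ℝ := 1 / (4 * N ^ 2 * ((k : ℝ) + 1)) with ht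
    have ht0 : 0 < t := by positivity
    have ht1 : t ≤ 1 := by
      rw [ht, div_le_one (by positivity)]
      nlinarith
    set w := (1 - t) • x + t • y with hw
    have hJw : ‖J w - w‖ ≤ 1 / ((j : ℝ) + 1) := by
      refine (sq_le_sq₀ (norm_nonneg _) (by positivity)).1 ?_
      refine (norm_sq_segment_sub_le hJ ht0.le ht1 hJx' hJy).trans ?_
      have hηj : η * (24 * N * ((j : ℝ) + 1) ^ 2) ≤ 1 := by
        rw [hη, one_div_mul_eq_div, div_le_one (by positivity)]
        push_cast
        linarith
      have hj1 : (1 : ℝ) ≤ (j : ℝ) + 1 := by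
        have : (0 : ℝ) ≤ j := Nat.cast_nonneg j
        linarith
      have hη1 : η ≤ 1 := by
        rw [hη, div_le_one (by positivity)]
        have : (0 : ℝ) ≤ ((24 * N * (j + 1) ^ 2 : ℕ) : ℝ) := Nat.cast_nonneg _
        linarith
      have h1 : η * ‖x - y‖ + η ^ 2 ≤ 3 * (η * N) := by
        have := mul_le_mul_of_nonneg_left hxy hη0
        nlinarith
      refine h1.trans ?_
      rw [div_pow, one_pow, le_div_iff₀ (by positivity)]
      linarith
    have hws : ‖w - s‖ ≤ N := by
      have e : w - s = (1 - t) • (x - s) + t • (y - s) := by rw [hw]; module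
      rw [e]
      refine (norm_add_le _ _).trans ?_
      rw [norm_smul, norm_smul, Real.norm_of_nonneg ht0.le, Real.norm_of_nonneg (sub_nonneg.2 ht1)]
      nlinarith
    have h1 := hmin w hws hJw
    have e : u - w = (u - x) - t • (y - x) := by rw [hw]; module
    rw [e, norm_sub_sq_real (u - x) (t • (y - x)), inner_smul_right, norm_smul,
      Real.norm_of_nonneg ht0.le, norm_sub_rev y x] at h1
    have h2 : (t * ‖x - y‖) ^ 2 ≤ t ^ 2 * (4 * N ^ 2) := by
      rw [mul_pow]
      have := pow_le_pow_left₀ (norm_nonneg _) hxy 2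
      nlinarith [sq_nonneg t]
    have h3 : t * (4 * N ^ 2) = 1 / ((k : ℝ) + 1) := by
      rw [ht]; field_simp
    have h4 : 1 / (4 * N ^ 2 * ((k : ℝ) + 1) ^ 2) = t * (1 / ((k : ℝ) + 1)) := by
      rw [ht]; field_simp
    rw [h4] at h1
    have h5 : t ^ 2 * (4 * N ^ 2) = t * (1 / ((k : ℝ) + 1)) := by rw [← h3]; ring
    have h6 : t * (2 * inner ℝ (u - x) (y - x)) ≤ t * (2 * (1 / ((k : ℝ) + 1))) := by linarith
    linarith [le_of_mul_le_mul_left h6 ht0]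

end Projection

/-! ### Recursive inequalities -/

section Recursion

/-- Solution of the recursion in Xu's lemma, over a finite range of indices. -/
theorem recursive_bound {s lam v err : ℕ → ℝ} {b : ℝ} {n q : ℕ}
    (hlam0 : ∀ i, 0 ≤ lam i) (hlam1 : ∀ i, lam i ≤ 1) (hv : ∀ i, 0 ≤ v i)
    (herr : ∀ i, 0 ≤ err i) (hb : 0 ≤ b)
    (hs : ∀ i, n ≤ i → i < q → s (i + 1) ≤ (1 - lam i) * (s i + v i) + lam i * b + err i)
    {m : ℕ} (hnm : n ≤ m) (hmq : m ≤ q) :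
    s m ≤ (∏ i ∈ Finset.Ico n m, (1 - lam i)) * s n +
      (∑ i ∈ Finset.Ico n m, v i + ∑ i ∈ Finset.Ico n m, err i) + b := by
  induction m, hnm using Nat.le_induction with
  | base => simpa using hb
  | succ m hnm ih =>
    have h1 := hs m hnm (by omega)
    have h2 := mul_le_mul_of_nonneg_left (ih (by omega)) (sub_nonneg.2 (hlam1 m))
    rw [Finset.prod_Ico_succ_top hnm, Finset.sum_Ico_succ_top hnm, Finset.sum_Ico_succ_top hnm]
    have h3 : 0 ≤ lam m * (∑ i ∈ Finset.Ico n m, v i + ∑ i ∈ Finset.Ico n m, err i) :=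
      mul_nonneg (hlam0 m) (add_nonneg (Finset.sum_nonneg fun i _ => hv i)
        (Finset.sum_nonneg fun i _ => herr i))
    have h4 := mul_nonneg (hlam0 m) (hv m)
    linarith

/-- A rate of divergence of `∑ λ_i` is a rate of convergence to `0` of `∏ (1 - λ_i)`, by
`1 - λ ≤ exp (-λ)`. The first `n - 1` terms of the sum contribute at most `n`. -/
theorem prod_one_sub_le {lam : ℕ → ℝ} {L : ℕ → ℕ} (hlam0 : ∀ i, 0 ≤ lam i)
    (hlam1 : ∀ i, lam i ≤ 1) (hL : ∀ k : ℕ, (k : ℝ) ≤ ∑ i ∈ Finset.Icc 1 (L k), lam i)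
    {n : ℕ} (hn : 1 ≤ n) {X : ℝ} (hX : 1 ≤ X) {m : ℕ} (hm : L (n + ⌈Real.log X⌉₊) + 1 ≤ m) :
    n ≤ m ∧ ∏ i ∈ Finset.Ico n m, (1 - lam i) ≤ 1 / X := by
  set h := n + ⌈Real.log X⌉₊ with hh
  have hL0 : h ≤ L h := by
    have h1 := (hL h).trans (Finset.sum_le_card_nsmul _ _ 1 fun i _ => hlam1 i)
    simpa using h1
  have hnm : n ≤ m := by omega
  refine ⟨hnm, ?_⟩
  have hsum : Real.log X ≤ ∑ i ∈ Finset.Ico n m, lam i := by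
    have h1 : ∑ i ∈ Finset.Icc 1 (L h), lam i ≤ ∑ i ∈ Finset.Ico 1 m, lam i :=
      Finset.sum_le_sum_of_subset_of_nonneg (fun i hi => by
        simp only [Finset.mem_Icc, Finset.mem_Ico] at hi ⊢
        omega) fun i _ _ => hlam0 i
    have h2 : ∑ i ∈ Finset.Ico 1 n, lam i ≤ n := by
      refine (Finset.sum_le_card_nsmul _ _ 1 fun i _ => hlam1 i).trans ?_
      simp
    have h3 := hL h
    rw [← Finset.sum_Ico_consecutive _ hn hnm] at h1
    have h4 := Nat.le_ceil (Real.log X)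
    rw [hh] at h3
    push_cast at h3
    rw [← hh] at h3
    linarith
  calc ∏ i ∈ Finset.Ico n m, (1 - lam i) ≤ ∏ i ∈ Finset.Ico n m, Real.exp (-lam i) :=
        Finset.prod_le_prod (fun i _ => sub_nonneg.2 (hlam1 i))
          fun i _ => by linarith [Real.add_one_le_exp (-lam i)]
    _ = Real.exp (-∑ i ∈ Finset.Ico n m, lam i) := by
        rw [← Real.exp_sum, Finset.sum_neg_distrib]
    _ ≤ Real.exp (-Real.log X) := Real.exp_le_exp.2 (neg_le_neg hsum)
    _ = 1 / X := by rw [Real.exp_neg, Real.exp_log (by linarith), one_div]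

end Recursion

/-! ### The iteration -/

section Iteration

theorem sum_range_error_le {H : Type*} [NormedAddCommGroup H] {e : ℕ → H} {E : ℕ → ℕ} {N₂ : ℕ}
    (hQ6 : ∀ k n : ℕ, ∑ i ∈ Finset.Icc (E k + 1) (E k + n), ‖e i‖ ≤ 1 / ((k : ℝ) + 1))
    (hN₂ : (∑ i ∈ Finset.range (E 0 + 1), ‖e i‖) + 1 ≤ (N₂ : ℝ)) (n : ℕ) :
    ∑ i ∈ Finset.range n, ‖e i‖ ≤ N₂ := by
  have h1 := hQ6 0 n
  have h2 : ∑ i ∈ Finset.range n, ‖e i‖ ≤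
      ∑ i ∈ Finset.range (E 0 + 1), ‖e i‖ + ∑ i ∈ Finset.Icc (E 0 + 1) (E 0 + n), ‖e i‖ := by
    rw [← Finset.sum_union (by
      rw [Finset.disjoint_left]
      intro i
      simp only [Finset.mem_range, Finset.mem_Icc]
      omega)]
    refine Finset.sum_le_sum_of_subset_of_nonneg (fun i hi => ?_) fun i _ _ => norm_nonneg _
    simp only [Finset.mem_range, Finset.mem_Icc, Finset.mem_union] at hi ⊢
    omega
  simp only [Nat.cast_zero, zero_add, div_one] at h1
  linarith

theorem norm_error_add_le {H : Type*} [NormedAddCommGroup H] {e : ℕ → H} {E : ℕ → ℕ}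
    (hQ6 : ∀ k n : ℕ, ∑ i ∈ Finset.Icc (E k + 1) (E k + n), ‖e i‖ ≤ 1 / ((k : ℝ) + 1))
    {k n : ℕ} (hn : E k + 1 ≤ n) : ‖e n‖ + ‖e (n + 1)‖ ≤ 1 / ((k : ℝ) + 1) := by
  refine le_trans ?_ (hQ6 k (n + 1))
  rw [← Finset.sum_pair (f := fun i => ‖e i‖) (show n ≠ n + 1 by omega)]
  refine Finset.sum_le_sum_of_subset_of_nonneg (fun i hi => ?_) fun i _ _ => norm_nonneg _
  simp only [Finset.mem_insert, Finset.mem_singleton, Finset.mem_Icc] at hi ⊢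
  omega

/-- The quantitative conditions on the parameters that make the iteration asymptotically regular:
`ℓ` is a rate of convergence to `0` of `lam`, `Γ` one of the differences of `cs`, and `E` a Cauchy
modulus of the series of errors; `γ` stays away from `0` and `1`, and `cs` from `0`. -/
structure HasModuli {H : Type*} [NormedAddCommGroup H] (lam γ cs : ℕ → ℝ) (e : ℕ → H) (a c : ℕ)
    (ℓ Γ E : ℕ → ℕ) : Prop where
  a_ne : a ≠ 0
  c_ne : c ≠ 0
  lam_le : ∀ k n : ℕ, ℓ k ≤ n → lam n ≤ 1 / ((k : ℝ) + 1)
  gam_mem : ∀ m : ℕ, 1 / (a : ℝ) ≤ γ m ∧ γ m ≤ 1 - 1 / (a : ℝ)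
  le_cs : ∀ n : ℕ, 1 / (c : ℝ) ≤ cs n
  abs_cs_sub_le : ∀ k n : ℕ, Γ k ≤ n → |cs (n + 1) - cs n| ≤ 1 / ((k : ℝ) + 1)
  sum_error_le : ∀ k n : ℕ, ∑ i ∈ Finset.Icc (E k + 1) (E k + n), ‖e i‖ ≤ 1 / ((k : ℝ) + 1)

variable {H : Type*} [NormedAddCommGroup H] [InnerProductSpace ℝ H]

/-- `z` is the multi-parameter proximal point iteration for the maximal monotone operator `T`, with
anchor `u` and errors `e`. The data include a zero `s` of `T` at distance at most `N₃` from `u` and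
`z 0`, and a bound `N₂` on all partial sums of the norms of the errors. -/
structure IsIteration (T : H → Set H) (lam γ δ cs : ℕ → ℝ) (u : H) (e z : ℕ → H) (s : H)
    (N₂ N₃ : ℕ) : Prop where
  maximal : IsMaximalMonotone T
  mem_zeros : s ∈ zeros T
  lam_mem : ∀ n, lam n ∈ Set.Ioo (0 : ℝ) 1
  gam_mem : ∀ n, γ n ∈ Set.Ioo (0 : ℝ) 1
  del_mem : ∀ n, δ n ∈ Set.Ioo (0 : ℝ) 1
  sum_eq : ∀ n, lam n + γ n + δ n = 1
  cs_pos : ∀ n, 0 < cs n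
  step : ∀ n, z (n + 1) = lam n • u + γ n • z n + δ n • resolvent T (cs n) (z n) + e n
  anchor_le : ‖u - s‖ ≤ N₃
  start_le : ‖z 0 - s‖ ≤ N₃
  sum_error_le : ∀ n, ∑ i ∈ Finset.range n, ‖e i‖ ≤ N₂

/-- The point `w n` for which `z (n + 1) = γ n • z n + (1 - γ n) • w n`; Suzuki's lemma is applied
to `z` and `w`. -/
noncomputable def avgPoint (T : H → Set H) (lam γ δ cs : ℕ → ℝ) (u : H) (e z : ℕ → H)
    (n : ℕ) : H :=
  (1 - γ n)⁻¹ • (lam n • u + δ n • resolvent T (cs n) (z n) + e n)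

namespace IsIteration

variable {T : H → Set H} {lam γ δ cs : ℕ → ℝ} {u s : H} {e z : ℕ → H} {N₂ N₃ : ℕ}

theorem norm_error_le (h : IsIteration T lam γ δ cs u e z s N₂ N₃) (n : ℕ) : ‖e n‖ ≤ N₂ := by
  refine le_trans ?_ (h.sum_error_le (n + 1))
  exact Finset.single_le_sum (f := fun i => ‖e i‖) (fun i _ => norm_nonneg _) (by simp)

theorem step_eq_avgPoint (h : IsIteration T lam γ δ cs u e z s N₂ N₃) (n : ℕ) :
    z (n + 1) = γ n • z n + (1 - γ n) • avgPoint T lam γ δ cs u e z n := by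
  have : 1 - γ n ≠ 0 := by linarith [(h.gam_mem n).2]
  rw [avgPoint, smul_smul, mul_inv_cancel₀ this, one_smul, h.step]
  abel

variable [CompleteSpace H]

theorem norm_resolvent_sub_zero_le (h : IsIteration T lam γ δ cs u e z s N₂ N₃) {c : ℝ}
    (hc : 0 < c) (x : H) : ‖resolvent T c x - s‖ ≤ ‖x - s‖ := by
  have := h.maximal.norm_resolvent_sub_le ⟨s, h.mem_zeros⟩ hc x s
  rwa [resolvent_of_mem_zeros h.maximal.1 h.mem_zeros hc] at this

theorem norm_sub_zero_le (h : IsIteration T lam γ δ cs u e z s N₂ N₃) (n : ℕ) :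
    ‖z n - s‖ ≤ N₂ + N₃ := by
  have main : ‖z n - s‖ ≤ N₃ + ∑ i ∈ Finset.range n, ‖e i‖ := by
    induction n with
    | zero => simpa using h.start_le
    | succ n ih =>
      set B : ℝ := N₃ + ∑ i ∈ Finset.range n, ‖e i‖ with hB
      have hB0 : 0 ≤ ∑ i ∈ Finset.range n, ‖e i‖ := Finset.sum_nonneg fun i _ => norm_nonneg _
      have e1 : z (n + 1) - s = lam n • (u - s) + γ n • (z n - s) +
          δ n • (resolvent T (cs n) (z n) - s) + e n := by
        have : s = (lam n + γ n + δ n) • s := by rw [h.sum_eq, one_smul]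
        rw [h.step]
        nth_rw 1 [this]
        module
      have hl := (h.lam_mem n).1
      have hg := (h.gam_mem n).1
      have hd := (h.del_mem n).1
      have hn : ‖z (n + 1) - s‖ ≤ lam n * ‖u - s‖ + γ n * ‖z n - s‖ +
          δ n * ‖resolvent T (cs n) (z n) - s‖ + ‖e n‖ := by
        rw [e1]
        refine (norm_add₄_le).trans_eq ?_
        rw [norm_smul, norm_smul, norm_smul, Real.norm_of_nonneg hl.le,
          Real.norm_of_nonneg hg.le, Real.norm_of_nonneg hd.le]
      have h1 := mul_le_mul_of_nonneg_left (show ‖u - s‖ ≤ B by linarith [h.anchor_le]) hl.le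
      have h2 := mul_le_mul_of_nonneg_left ih hg.le
      have h3 := mul_le_mul_of_nonneg_left
        ((h.norm_resolvent_sub_zero_le (h.cs_pos n) (z n)).trans ih) hd.le
      have h4 : lam n * B + γ n * B + δ n * B = B := by
        rw [← add_mul, ← add_mul, h.sum_eq, one_mul]
      rw [Finset.sum_range_succ]
      linarith
  linarith [h.sum_error_le n]

theorem norm_anchor_sub_resolvent_le (h : IsIteration T lam γ δ cs u e z s N₂ N₃) (n : ℕ) :
    ‖u - resolvent T (cs n) (z n)‖ ≤ N₂ + N₃ + N₃ := by
  have h1 := norm_sub_le_norm_sub_add_norm_sub u s (resolvent T (cs n) (z n))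
  rw [norm_sub_rev s] at h1
  linarith [h.anchor_le, h.norm_resolvent_sub_zero_le (h.cs_pos n) (z n), h.norm_sub_zero_le n]

theorem norm_avgPoint_sub_resolvent_le (h : IsIteration T lam γ δ cs u e z s N₂ N₃) {a : ℕ}
    (ha : a ≠ 0) (hQ3 : ∀ m : ℕ, 1 / (a : ℝ) ≤ γ m ∧ γ m ≤ 1 - 1 / (a : ℝ)) (n : ℕ) :
    ‖avgPoint T lam γ δ cs u e z n - resolvent T (cs n) (z n)‖ ≤
      a * (lam n * (N₂ + N₃ + N₃) + ‖e n‖) := by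
  have hg : 0 < 1 - γ n := by linarith [(h.gam_mem n).2]
  have ha0 : (0 : ℝ) < a := by positivity
  have e1 : avgPoint T lam γ δ cs u e z n - resolvent T (cs n) (z n) =
      (1 - γ n)⁻¹ • (lam n • (u - resolvent T (cs n) (z n)) + e n) := by
    have hd : δ n = 1 - γ n - lam n := by linarith [h.sum_eq n]
    have : resolvent T (cs n) (z n) =
        (1 - γ n)⁻¹ • ((1 - γ n) • resolvent T (cs n) (z n)) := by
      rw [smul_smul, inv_mul_cancel₀ hg.ne', one_smul]
    nth_rw 1 [this]
    rw [avgPoint, ← smul_sub, hd]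
    congr 1
    module
  have hinv : (1 - γ n)⁻¹ ≤ a := by
    rw [inv_le_comm₀ hg ha0, ← one_div]
    linarith [(hQ3 n).2]
  rw [e1, norm_smul, norm_inv, Real.norm_of_nonneg hg.le]
  have h1 : ‖lam n • (u - resolvent T (cs n) (z n)) + e n‖ ≤
      lam n * (N₂ + N₃ + N₃) + ‖e n‖ := by
    refine (norm_add_le _ _).trans ?_
    rw [norm_smul, Real.norm_of_nonneg (h.lam_mem n).1.le]
    have := mul_le_mul_of_nonneg_left (h.norm_anchor_sub_resolvent_le n) (h.lam_mem n).1.le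
    linarith
  gcongr

theorem norm_avgPoint_sub_zero_le (h : IsIteration T lam γ δ cs u e z s N₂ N₃) {a : ℕ}
    (ha : a ≠ 0) (hQ3 : ∀ m : ℕ, 1 / (a : ℝ) ≤ γ m ∧ γ m ≤ 1 - 1 / (a : ℝ)) (n : ℕ) :
    ‖avgPoint T lam γ δ cs u e z n - s‖ ≤ 2 * a * (N₂ + N₃) := by
  have hg : 0 < 1 - γ n := by linarith [(h.gam_mem n).2]
  have ha1 : (1 : ℝ) ≤ a := by exact_mod_cast Nat.one_le_iff_ne_zero.2 ha
  have hN2 : (0 : ℝ) ≤ N₂ := Nat.cast_nonneg _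
  have hN3 : (0 : ℝ) ≤ N₃ := Nat.cast_nonneg _
  have e1 : (1 - γ n) • (avgPoint T lam γ δ cs u e z n - s) =
      lam n • (u - s) + δ n • (resolvent T (cs n) (z n) - s) + e n := by
    have hd : 1 - γ n = lam n + δ n := by linarith [h.sum_eq n]
    rw [smul_sub, avgPoint, smul_smul, mul_inv_cancel₀ hg.ne', one_smul, hd]
    module
  have hl := (h.lam_mem n).1
  have hd := (h.del_mem n).1
  have h1 : (1 - γ n) * ‖avgPoint T lam γ δ cs u e z n - s‖ ≤
      lam n * ‖u - s‖ + δ n * ‖resolvent T (cs n) (z n) - s‖ + ‖e n‖ := by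
    have := congrArg norm e1
    rw [norm_smul, Real.norm_of_nonneg hg.le] at this
    rw [this]
    refine norm_add₃_le.trans_eq ?_
    rw [norm_smul, norm_smul, Real.norm_of_nonneg hl.le, Real.norm_of_nonneg hd.le]
  have h2 := mul_le_mul_of_nonneg_left
    (show ‖u - s‖ ≤ N₂ + N₃ by linarith [h.anchor_le]) hl.le
  have h3 := mul_le_mul_of_nonneg_left
    ((h.norm_resolvent_sub_zero_le (h.cs_pos n) (z n)).trans (h.norm_sub_zero_le n)) hd.le
  have h4 : 1 ≤ (1 - γ n) * a := by
    have := (hQ3 n).2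
    rw [← div_le_iff₀ (by linarith)]
    linarith
  have h5 : (1 - γ n) * ‖avgPoint T lam γ δ cs u e z n - s‖ ≤
      (1 - γ n) * (N₂ + N₃ + a * N₂) := by
    have h6 := mul_le_mul_of_nonneg_right h4 hN2
    have h7 : lam n + δ n = 1 - γ n := by linarith [h.sum_eq n]
    have h8 : (lam n + δ n) * ((N₂ : ℝ) + N₃) = (1 - γ n) * (N₂ + N₃) := by rw [h7]
    linarith [h.norm_error_le n]
  have h6 := le_of_mul_le_mul_left h5 hg
  have h7 := mul_le_mul_of_nonneg_right ha1 (add_nonneg hN2 hN3)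
  have h8 := mul_nonneg (by linarith : (0 : ℝ) ≤ a) hN3
  linarith

/-- The hypothesis of Suzuki's lemma. The anchor, the errors and the change of the resolvent parameter
contribute at most `1 / (5 (k + 1))` each. -/
theorem norm_avgPoint_succ_sub_le (h : IsIteration T lam γ δ cs u e z s N₂ N₃) {a c : ℕ}
    {ℓ Γ E : ℕ → ℕ}
    (hq : HasModuli lam γ cs e a c ℓ Γ E)
    (N₁ : ℕ) {k n : ℕ} (hn : nu a c ℓ Γ E N₁ N₂ N₃ k ≤ n) :
    ‖avgPoint T lam γ δ cs u e z (n + 1) - avgPoint T lam γ δ cs u e z n‖ ≤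
      ‖z (n + 1) - z n‖ + 1 / ((k : ℝ) + 1) := by
  obtain ⟨ha, hc, hQ1, hQ3, hQ4, hQ5, hQ6⟩ := hq
  have ha0 : (0 : ℝ) < a := by positivity
  have hc0 : (0 : ℝ) < c := by positivity
  have hk0 : (0 : ℝ) < (k : ℝ) + 1 := by positivity
  have hN0 : (0 : ℝ) ≤ (N₂ : ℝ) + N₃ := by positivity
  unfold nu at hn
  have hn1 := (le_max_left _ _).trans hn
  have hn2 := ((le_max_left _ _).trans (le_max_right _ _)).trans hn
  have hn3 := ((le_max_right _ _).trans (le_max_right _ _)).trans hn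
  -- the contribution of the anchor
  have hlam : ∀ m, n ≤ m → a * (lam m * (N₂ + N₃ + N₃)) ≤ 1 / (10 * ((k : ℝ) + 1)) := by
    intro m hm
    have h1 := hQ1 _ m (hn2.trans hm)
    rw [le_div_iff₀ (by positivity)] at h1 ⊢
    push_cast at h1
    have hl := (h.lam_mem m).1.le
    have : 0 ≤ lam m * (a * N₁ * (k + 1)) := by positivity
    linarith
  -- the contribution of the errors
  have herr : a * (‖e n‖ + ‖e (n + 1)‖) ≤ 1 / (5 * ((k : ℝ) + 1)) := by
    have h1 := norm_error_add_le hQ6 hn3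
    rw [le_div_iff₀ (by positivity)] at h1 ⊢
    push_cast at h1
    linarith [norm_nonneg (e n), norm_nonneg (e (n + 1))]
  -- the contribution of the changing parameters of the resolvents
  have hres : ‖resolvent T (cs (n + 1)) (z (n + 1)) - resolvent T (cs n) (z n)‖ ≤
      ‖z (n + 1) - z n‖ + 1 / (5 * ((k : ℝ) + 1)) := by
    have h1 := h.maximal.norm_resolvent_sub_resolvent_le ⟨s, h.mem_zeros⟩ (h.cs_pos n)
      (h.cs_pos (n + 1)) (z n) (z (n + 1))
    have h2 : |cs n / cs (n + 1) - 1| ≤ c * |cs (n + 1) - cs n| := by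
      have hp := h.cs_pos (n + 1)
      have : cs n / cs (n + 1) - 1 = -((cs (n + 1) - cs n) / cs (n + 1)) := by
        field_simp
        ring
      rw [this, abs_neg, abs_div, abs_of_pos hp, div_le_iff₀ hp]
      have h3 : 1 ≤ c * cs (n + 1) := by
        have := hQ4 (n + 1)
        rwa [div_le_iff₀' hc0] at this
      have := mul_le_mul_of_nonneg_right h3 (abs_nonneg (cs (n + 1) - cs n))
      linarith
    have h3 : ‖z (n + 1) - resolvent T (cs (n + 1)) (z (n + 1))‖ ≤ 2 * (N₂ + N₃) := by
      have h4 := norm_sub_le_norm_sub_add_norm_sub (z (n + 1)) s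
        (resolvent T (cs (n + 1)) (z (n + 1)))
      rw [norm_sub_rev s] at h4
      linarith [h.norm_resolvent_sub_zero_le (h.cs_pos (n + 1)) (z (n + 1)),
        h.norm_sub_zero_le (n + 1)]
    have h4 := hQ5 _ n hn1
    rw [le_div_iff₀ (by positivity)] at h4
    push_cast at h4
    have h5 : c * |cs (n + 1) - cs n| * (2 * (N₂ + N₃)) ≤ 1 / (5 * ((k : ℝ) + 1)) := by
      rw [le_div_iff₀ (by positivity)]
      have ha1 : (1 : ℝ) ≤ a := by exact_mod_cast Nat.one_le_iff_ne_zero.2 ha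
      have h6 : 0 ≤ c * |cs (n + 1) - cs n| * (10 * (N₂ + N₃) * (k + 1)) := by positivity
      have h7 := mul_le_mul_of_nonneg_right ha1 h6
      linarith [abs_nonneg (cs (n + 1) - cs n)]
    have h6 := mul_le_mul h2 h3 (norm_nonneg _) (by positivity)
    linarith
  have hw1 := h.norm_avgPoint_sub_resolvent_le ha hQ3 n
  have hw2 := h.norm_avgPoint_sub_resolvent_le ha hQ3 (n + 1)
  have ht1 := norm_sub_le_norm_sub_add_norm_sub (avgPoint T lam γ δ cs u e z (n + 1))
    (resolvent T (cs (n + 1)) (z (n + 1))) (avgPoint T lam γ δ cs u e z n)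
  have ht2 := norm_sub_le_norm_sub_add_norm_sub (resolvent T (cs (n + 1)) (z (n + 1)))
    (resolvent T (cs n) (z n)) (avgPoint T lam γ δ cs u e z n)
  rw [norm_sub_rev (resolvent T (cs n) (z n)) (avgPoint _ _ _ _ _ _ _ _ _)] at ht2
  have hl1 := hlam n le_rfl
  have hl2 := hlam (n + 1) (by omega)
  have e1 : 1 / (5 * ((k : ℝ) + 1)) = 1 / 5 * (1 / (k + 1)) := by field_simp
  have e2 : 1 / (10 * ((k : ℝ) + 1)) = 1 / 10 * (1 / (k + 1)) := by field_simp
  have e3 : 0 < 1 / ((k : ℝ) + 1) := by positivity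
  rw [e1] at herr hres
  rw [e2] at hl1 hl2
  linarith

/-- Asymptotic regularity of the iteration, from Suzuki's lemma. -/
theorem avgPoint_metastable (h : IsIteration T lam γ δ cs u e z s N₂ N₃) {a c : ℕ}
    {ℓ Γ E : ℕ → ℕ}
    (hq : HasModuli lam γ cs e a c ℓ Γ E)
    {N₁ : ℕ} (hN₁ : ‖u‖ ≤ N₁) (hN₂ : 0 < N₂) (k : ℕ) {f : ℕ → ℕ} (hf : Monotone f) :
    ∃ n ≤ chi0 a c ℓ Γ E N₁ N₂ N₃ k f, ∀ i, n ≤ i → i ≤ n + f n →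
      ‖avgPoint T lam γ δ cs u e z i - z i‖ ≤ 1 / ((k : ℝ) + 1) := by
  have ha := hq.a_ne
  have hQ3 := hq.gam_mem
  have ha1 : (1 : ℝ) ≤ a := by exact_mod_cast Nat.one_le_iff_ne_zero.2 ha
  have hs : ‖s‖ ≤ N₁ + N₃ := by
    have h1 := norm_sub_norm_le s u
    rw [norm_sub_rev] at h1
    linarith [h.anchor_le]
  refine suzuki_metastable (Nat.pos_of_ne_zero ha) (by positivity) hQ3 h.step_eq_avgPoint ?_ ?_
    (fun k n hn => h.norm_avgPoint_succ_sub_le hq N₁ hn) k hf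
  · intro i
    have h1 := norm_sub_norm_le (z i) s
    have h2 := h.norm_sub_zero_le i
    have h3 := mul_le_mul_of_nonneg_right ha1 (show (0 : ℝ) ≤ N₂ + N₃ by positivity)
    push_cast
    linarith [show (0 : ℝ) ≤ N₂ + N₃ by positivity]
  · intro i
    have h1 := norm_sub_norm_le (avgPoint T lam γ δ cs u e z i) s
    have h2 := h.norm_avgPoint_sub_zero_le ha hQ3 i
    push_cast
    linarith

/-- The iterates are approximate fixed points of one fixed resolvent, of parameter `1 / c`. Half of the
accuracy is spent on passing from the parameters `cs i` to `1 / c`. -/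
theorem resolvent_metastable (h : IsIteration T lam γ δ cs u e z s N₂ N₃) {a c : ℕ}
    {ℓ Γ E : ℕ → ℕ}
    (hq : HasModuli lam γ cs e a c ℓ Γ E)
    {N₁ : ℕ} (hN₁ : ‖u‖ ≤ N₁) (hN₂ : 0 < N₂) (k : ℕ) {f : ℕ → ℕ} (hf : Monotone f) :
    ∃ n ≤ xi a (mu a ℓ E N₂ N₃) (chi0 a c ℓ Γ E N₁ N₂ N₃) k f, ∀ i, n ≤ i → i ≤ n + f n →
      ‖resolvent T (1 / (c : ℝ)) (z i) - z i‖ ≤ 1 / ((k : ℝ) + 1) := by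
  have ha := hq.a_ne
  have hc := hq.c_ne
  have hQ1 := hq.lam_le
  have hQ3 := hq.gam_mem
  have hQ4 := hq.le_cs
  have hQ6 := hq.sum_error_le
  have ha0 : (0 : ℝ) < a := by positivity
  have ha1 : (1 : ℝ) ≤ a := by exact_mod_cast Nat.one_le_iff_ne_zero.2 ha
  have hc0 : (0 : ℝ) < c := by positivity
  have hk0 : (0 : ℝ) < (k : ℝ) + 1 := by positivity
  set m₀ := mu a ℓ E N₂ N₃ (2 * k + 1) with hm₀
  obtain ⟨m, hm1, hm2⟩ := h.avgPoint_metastable hq hN₁ hN₂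
    (4 * a * (k + 1)) (f := fun m => m₀ + f (max m₀ m))
    fun i j hij => Nat.add_le_add_left (hf (max_le_max le_rfl hij)) _
  refine ⟨max m₀ m, max_le_max le_rfl hm1, fun i hi1 hi2 => ?_⟩
  have hi3 : m₀ ≤ i := (le_max_left _ _).trans hi1
  have hw := hm2 i ((le_max_right _ _).trans hi1) (by
    have : max m₀ m ≤ m₀ + m := max_le (by omega) (by omega)
    omega)
  have hw' : ‖avgPoint T lam γ δ cs u e z i - z i‖ ≤ 1 / (4 * ((k : ℝ) + 1)) := by
    refine hw.trans ?_
    push_cast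
    have := mul_le_mul_of_nonneg_right ha1 (show (0 : ℝ) ≤ 4 * (k + 1) by positivity)
    refine one_div_le_one_div_of_le (by positivity) ?_
    linarith
  rw [hm₀, mu] at hi3
  have hlam : a * (lam i * (N₂ + N₃ + N₃)) ≤ 1 / (8 * ((k : ℝ) + 1)) := by
    have h1 := hQ1 _ i ((le_max_left _ _).trans hi3)
    rw [le_div_iff₀ (by positivity)] at h1 ⊢
    push_cast at h1
    linarith [(h.lam_mem i).1]
  have herr : a * ‖e i‖ ≤ 1 / (8 * ((k : ℝ) + 1)) := by
    have h1 := norm_error_add_le hQ6 ((le_max_right _ _).trans hi3)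
    have h2 := (le_add_of_nonneg_right (norm_nonneg (e (i + 1)))).trans h1
    rw [le_div_iff₀ (by positivity)] at h2 ⊢
    push_cast at h2
    linarith [norm_nonneg (e i)]
  have h1 := h.norm_avgPoint_sub_resolvent_le ha hQ3 i
  have h2 := norm_sub_le_norm_sub_add_norm_sub (resolvent T (cs i) (z i))
    (avgPoint T lam γ δ cs u e z i) (z i)
  rw [norm_sub_rev (resolvent T (cs i) (z i)) (avgPoint _ _ _ _ _ _ _ _ _)] at h2
  have h3 := h.maximal.norm_sub_resolvent_le_two_mul ⟨s, h.mem_zeros⟩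
    (c := 1 / (c : ℝ)) (by positivity) (hQ4 i) (z i)
  have e1 : 1 / (8 * ((k : ℝ) + 1)) = 1 / 8 * (1 / (k + 1)) := by field_simp
  have e2 : 1 / (4 * ((k : ℝ) + 1)) = 1 / 4 * (1 / (k + 1)) := by field_simp
  rw [e1] at hlam herr
  rw [e2] at hw'
  linarith

/-- The approximate projection `x` of `u` onto the zeros of `T`, with its variational inequality at
the iterates. Its accuracy as a fixed point is measured by `f n`, hence can be made to depend on `n`. -/
theorem projection_metastable (h : IsIteration T lam γ δ cs u e z s N₂ N₃) {a c : ℕ}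
    {ℓ Γ E : ℕ → ℕ} (hq : HasModuli lam γ cs e a c ℓ Γ E)
    (hℓ : Monotone ℓ) (hΓ : Monotone Γ) (hE : Monotone E)
    {N₁ : ℕ} (hN₁ : ‖u‖ ≤ N₁) (hN₂ : 0 < N₂) (k : ℕ) {f : ℕ → ℕ} (hf : Monotone f) :
    ∃ n ≤ psi (NBall N₂ N₃) (xi a (mu a ℓ E N₂ N₃) (chi0 a c ℓ Γ E N₁ N₂ N₃)) k f,
      ∃ x, ‖x - s‖ ≤ NBall N₂ N₃ ∧ ‖resolvent T (1 / (c : ℝ)) x - x‖ ≤ 1 / ((f n : ℝ) + 1) ∧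
        ∀ i, n ≤ i → i ≤ n + f n → inner ℝ (u - x) (z i - x) ≤ 1 / ((k : ℝ) + 1) := by
  have hc := hq.c_ne
  have ha := hq.a_ne
  set N := NBall N₂ N₃ with hN
  have hN1 : 2 * N₃ ≤ N := le_max_left _ _
  have hN2 : N₂ + N₃ ≤ N := le_max_right _ _
  have hN1' : (2 * N₃ : ℝ) ≤ N := by exact_mod_cast hN1
  have hN2' : (N₂ + N₃ : ℝ) ≤ N := by exact_mod_cast hN2
  have hc0 : (0 : ℝ) < 1 / (c : ℝ) := by positivity
  set ξ := xi a (mu a ℓ E N₂ N₃) (chi0 a c ℓ Γ E N₁ N₂ N₃) with hξ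
  have hf1 : Monotone fun i => f i + 1 := fun i j hij => Nat.add_le_add_right (hf hij) _
  obtain ⟨j, hj, x, hx, hJx, hproj⟩ := exists_approx_projection (u := u)
    (h.maximal.norm_resolvent_sub_le ⟨s, h.mem_zeros⟩ hc0)
    (resolvent_of_mem_zeros h.maximal.1 h.mem_zeros hc0) (N := N) (by omega)
    (by linarith [h.anchor_le]) k (fun m => f (ξ m fun i => f i + 1))
  obtain ⟨n, hn, hres⟩ := h.resolvent_metastable hq hN₁ hN₂
    (24 * N * (j + 1) ^ 2) hf1
  refine ⟨n, hn.trans ?_, x, hx, hJx.trans ?_, fun i h1 h2 => hproj _ ?_ (hres i h1 ?_)⟩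
  · refine xi_mono (mu_mono hℓ hE) (fun hk hf hff' => ?_) hf1 ?_
    · exact chiTilde_le_chiTilde hf hff' hk (Nat.pos_of_ne_zero ha) (nu_mono hℓ hΓ hE) _
    · gcongr
  · have := hf hn
    gcongr
  · exact (h.norm_sub_zero_le i).trans hN2'
  · omega

end IsIteration

end Iteration

/-! ### Convergence -/

section Convergence

variable {H : Type*} [NormedAddCommGroup H] [InnerProductSpace ℝ H] [CompleteSpace H]
  {T : H → Set H} {lam γ δ cs : ℕ → ℝ} {u s : H} {e z : ℕ → H} {N₂ N₃ a c : ℕ}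
  {ℓ L Γ E C : ℕ → ℕ}

namespace IsIteration

/-- `projection_metastable` in the form used by the recursive inequality: `x` is an approximate fixed
point of all resolvents of parameter `cs i` with `i ≤ f n`. -/
theorem residual_metastable (h : IsIteration T lam γ δ cs u e z s N₂ N₃)
    (hq : HasModuli lam γ cs e a c ℓ Γ E) (hℓ : Monotone ℓ) (hΓ : Monotone Γ) (hE : Monotone E)
    (hC : Monotone C) (hcsC : ∀ n, cs n ≤ (C n : ℝ)) {N₁ : ℕ} (hN₁ : ‖u‖ ≤ N₁) (hN₂ : 0 < N₂)
    (k : ℕ) {f : ℕ → ℕ} (hf : Monotone f) :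
    ∃ n ≤ Psi c C (NBall N₂ N₃)
        (psi (NBall N₂ N₃) (xi a (mu a ℓ E N₂ N₃) (chi0 a c ℓ Γ E N₁ N₂ N₃))) k f,
      ∃ x, ‖x - s‖ ≤ NBall N₂ N₃ ∧
        (∀ i ≤ f n, ‖resolvent T (cs i) x - x‖ *
          (‖resolvent T (cs i) x - x‖ + 4 * NBall N₂ N₃) ≤ 1 / ((f n : ℝ) + 1)) ∧
        ∀ i, n ≤ i → i ≤ f n → 2 * inner ℝ (u - x) (z i - x) ≤ 1 / ((k : ℝ) + 1) := by
  set N := NBall N₂ N₃ with hN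
  have hc0 : (0 : ℝ) < c := by exact_mod_cast Nat.pos_of_ne_zero hq.c_ne
  have hCpos : ∀ n, 0 < C n := fun n => by
    exact_mod_cast (h.cs_pos n).trans_le (hcsC n)
  set g : ℕ → ℕ := fun m => zeta c C ((1 + 4 * N) * (f m + 1) - 1) (f m) with hg
  have hg1 : ∀ m, g m + 1 = C (f m) * c * ((1 + 4 * N) * (f m + 1)) := by
    intro m
    have h1 : 0 < (1 + 4 * N) * (f m + 1) := by positivity
    have h2 : 0 < C (f m) * c * ((1 + 4 * N) * (f m + 1)) :=
      Nat.mul_pos (Nat.mul_pos (hCpos _) (Nat.pos_of_ne_zero hq.c_ne)) h1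
    simp only [hg, zeta]
    rw [Nat.sub_add_cancel h1, Nat.sub_add_cancel h2]
  have hgmono : Monotone g := by
    intro i j hij
    have h1 : g i + 1 ≤ g j + 1 := by
      rw [hg1, hg1]
      have h2 := hf hij
      have h3 := hC h2
      gcongr
    omega
  have hfg : ∀ m, f m ≤ g m := by
    intro m
    have h1 : 1 ≤ C (f m) * c := Nat.mul_pos (hCpos _) (Nat.pos_of_ne_zero hq.c_ne)
    have h2 : f m + 1 ≤ g m + 1 := by
      rw [hg1]
      calc f m + 1 ≤ (1 + 4 * N) * (f m + 1) := Nat.le_mul_of_pos_left _ (by omega)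
        _ ≤ _ := Nat.le_mul_of_pos_left _ h1
    omega
  obtain ⟨n, hn, x, hx, hJx, hproj⟩ := h.projection_metastable hq hℓ hΓ hE hN₁ hN₂ (2 * k + 1)
    hgmono
  refine ⟨n, hn, x, hx, fun i hi => ?_, fun i h1 h2 => ?_⟩
  · set d := ‖resolvent T (cs i) x - x‖ with hd
    have hB : (0 : ℝ) < 1 + 4 * N := by positivity
    have hF : (1 : ℝ) ≤ (f n : ℝ) + 1 := by
      linarith [(Nat.cast_nonneg (f n) : (0 : ℝ) ≤ f n)]
    have h1 := h.maximal.norm_sub_resolvent_le_div_mul ⟨s, h.mem_zeros⟩ (c := 1 / (c : ℝ))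
      (by positivity) (hq.le_cs i) x
    have hcast : (g n : ℝ) + 1 = C (f n) * c * ((1 + 4 * N) * (f n + 1)) := by
      exact_mod_cast hg1 n
    have hCi : cs i ≤ C (f n) := (hcsC i).trans (by exact_mod_cast hC hi)
    have hC0 : (0 : ℝ) < C (f n) := by exact_mod_cast hCpos _
    have hdle : d * ((1 + 4 * N) * (f n + 1)) ≤ 1 := by
      rw [le_div_iff₀ (by positivity), hcast] at hJx
      have e1 : cs i / (1 / (c : ℝ)) = cs i * c := by field_simp
      rw [e1] at h1
      have h2 : cs i * c ≤ C (f n) * c := mul_le_mul_of_nonneg_right hCi hc0.le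
      have h3 := h1.trans (mul_le_mul_of_nonneg_right h2 (norm_nonneg _))
      have h4 := mul_le_mul_of_nonneg_right h3
        (show (0 : ℝ) ≤ (1 + 4 * N) * (f n + 1) by positivity)
      linarith
    have hd0 : 0 ≤ d := norm_nonneg _
    have hN0 : (0 : ℝ) ≤ N := Nat.cast_nonneg N
    have hd1 : d ≤ 1 := by
      have : (1 : ℝ) ≤ (1 + 4 * N) * (f n + 1) := by nlinarith
      have := mul_le_mul_of_nonneg_left this hd0
      linarith
    rw [le_div_iff₀ (by positivity)]
    have h2 : d * (d + 4 * N) ≤ d * (1 + 4 * N) := by gcongr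
    have := mul_le_mul_of_nonneg_right h2 (show (0 : ℝ) ≤ (f n : ℝ) + 1 by positivity)
    linarith
  · have h3 := hproj i h1 (h2.trans ((hfg n).trans (by omega)))
    push_cast at h3
    have e1 : 1 / (2 * (k : ℝ) + 1 + 1) = 1 / 2 * (1 / (k + 1)) := by
      field_simp
      ring
    rw [e1] at h3
    linarith

/-- The recursive inequality of Xu's lemma for `‖z n - x‖²`, at a point `x` that need not be fixed by
the resolvents. -/
theorem norm_sq_succ_le (h : IsIteration T lam γ δ cs u e z s N₂ N₃) {x : H} {N : ℝ}
    (hx : ‖x - s‖ ≤ N) (hN : N₂ + N₃ ≤ N) (n : ℕ) :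
    ‖z (n + 1) - x‖ ^ 2 ≤ (1 - lam n) * (‖z n - x‖ ^ 2 + ‖resolvent T (cs n) x - x‖ *
      (‖resolvent T (cs n) x - x‖ + 4 * N)) + lam n * (2 * inner ℝ (u - x) (z (n + 1) - x)) +
      4 * N * ‖e n‖ := by
  set J := resolvent T (cs n) (z n) with hJ
  set d := ‖resolvent T (cs n) x - x‖ with hd
  have hd0 : 0 ≤ d := norm_nonneg _
  obtain ⟨hl0, hl1⟩ := h.lam_mem n
  have hzx : ∀ m, ‖z m - x‖ ≤ 2 * N := fun m => by
    have h1 := norm_sub_le_norm_sub_add_norm_sub (z m) s x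
    rw [norm_sub_rev s] at h1
    linarith [h.norm_sub_zero_le m]
  have hJx : ‖J - x‖ ≤ ‖z n - x‖ + d := by
    have h1 := norm_sub_le_norm_sub_add_norm_sub J (resolvent T (cs n) x) x
    have h2 := h.maximal.norm_resolvent_sub_le ⟨s, h.mem_zeros⟩ (h.cs_pos n) (z n) x
    linarith
  set b := γ n • (z n - x) + δ n • (J - x) with hb
  set p := lam n • (u - x) + e n with hp
  have hbp : z (n + 1) - x = b + p := by
    have : x = (lam n + γ n + δ n) • x := by rw [h.sum_eq, one_smul]
    rw [h.step, hb, hp, ← hJ]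
    nth_rw 1 [this]
    module
  have hbn : ‖b‖ ≤ (1 - lam n) * (‖z n - x‖ + d) := by
    have hg0 := (h.gam_mem n).1.le
    have hδ0 := (h.del_mem n).1.le
    have h1 := norm_add_le (γ n • (z n - x)) (δ n • (J - x))
    rw [norm_smul, norm_smul, Real.norm_of_nonneg hg0, Real.norm_of_nonneg hδ0] at h1
    have h2 := mul_le_mul_of_nonneg_left hJx hδ0
    have h3 : 1 - lam n = γ n + δ n := by linarith [h.sum_eq n]
    rw [h3]
    linarith [mul_nonneg hg0 hd0]
  have hbsq : ‖b‖ ^ 2 ≤ (1 - lam n) * (‖z n - x‖ ^ 2 + d * (d + 4 * N)) := by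
    have h1 := pow_le_pow_left₀ (norm_nonneg _) hbn 2
    have h2 : ((1 - lam n) * (‖z n - x‖ + d)) ^ 2 ≤ (1 - lam n) * (‖z n - x‖ + d) ^ 2 := by
      rw [mul_pow]
      refine mul_le_mul_of_nonneg_right ?_ (sq_nonneg _)
      nlinarith
    have h3 : (‖z n - x‖ + d) ^ 2 ≤ ‖z n - x‖ ^ 2 + d * (d + 4 * N) := by
      have := mul_le_mul_of_nonneg_left (hzx n) hd0
      linarith
    exact (h1.trans h2).trans (mul_le_mul_of_nonneg_left h3 (by linarith))
  have hsub : ‖b + p‖ ^ 2 ≤ ‖b‖ ^ 2 + 2 * inner ℝ p (b + p) := by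
    rw [norm_add_sq_real, inner_add_right p b p, real_inner_self_eq_norm_sq, real_inner_comm b p]
    linarith [sq_nonneg ‖p‖]
  have hin : inner ℝ p (b + p) ≤
      lam n * inner ℝ (u - x) (z (n + 1) - x) + ‖e n‖ * (2 * N) := by
    rw [← hbp, hp, inner_add_left, inner_smul_left]
    have h1 := real_inner_le_norm (e n) (z (n + 1) - x)
    have h2 := mul_le_mul_of_nonneg_left (hzx (n + 1)) (norm_nonneg (e n))
    simp only [conj_trivial]
    linarith
  rw [← hbp] at hsub hin
  linarith

/-- The iterates stay close to one point on a long interval: the recursive inequality is solved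
between `max n (G (4 k + 3) + 1)` and `m`. -/
theorem norm_sq_metastable (h : IsIteration T lam γ δ cs u e z s N₂ N₃)
    (hq : HasModuli lam γ cs e a c ℓ Γ E) (hℓ : Monotone ℓ) (hL : Monotone L) (hΓ : Monotone Γ)
    (hE : Monotone E) (hC : Monotone C)
    (hQ2 : ∀ k : ℕ, (k : ℝ) ≤ ∑ i ∈ Finset.Icc 1 (L k), lam i)
    (hcsC : ∀ n, cs n ≤ (C n : ℝ)) {N₁ : ℕ} (hN₁ : ‖u‖ ≤ N₁) (hN₂ : 0 < N₂)
    (k : ℕ) {f : ℕ → ℕ} (hf : Monotone f) :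
    ∃ n ≤ Theta k f L (Psi c C (NBall N₂ N₃)
        (psi (NBall N₂ N₃) (xi a (mu a ℓ E N₂ N₃) (chi0 a c ℓ Γ E N₁ N₂ N₃))))
        (fun i => E (M2 N₂ N₃ * (i + 1))) (4 * NBall N₂ N₃ ^ 2),
      ∃ x, ∀ m, n ≤ m → m ≤ f n → ‖z m - x‖ ^ 2 ≤ 1 / ((k : ℝ) + 1) := by
  set N := NBall N₂ N₃ with hN
  set G : ℕ → ℕ := fun i => E (M2 N₂ N₃ * (i + 1)) with hG
  set D := 4 * N ^ 2 with hD
  have hN2 : N₂ + N₃ ≤ N := le_max_right _ _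
  have hN2' : (N₂ + N₃ : ℝ) ≤ N := by exact_mod_cast hN2
  have hN1 : 1 ≤ N := by omega
  have hk0 : (0 : ℝ) < (k : ℝ) + 1 := by positivity
  have hη : Monotone (hTheta k G D) := fun i j hij =>
    Nat.add_le_add_right (max_le_max hij le_rfl) _
  -- `g n` bounds the number of steps of the recursion and makes each residual small enough for
  -- their sum
  set g : ℕ → ℕ := fun m => 4 * (k + 1) * (f (L (hTheta k G D m) + 1) + 1) with hg
  have hgmono : Monotone g := by
    intro i j hij
    have := hf (Nat.add_le_add_right (hL (hη hij)) 1)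
    simp only [hg]
    gcongr
  obtain ⟨n, hn, x, hx, hres, hproj⟩ := h.residual_metastable hq hℓ hΓ hE hC hcsC hN₁ hN₂
    (4 * k + 3) hgmono
  set σ := L (hTheta k G D n) + 1 with hσ
  refine ⟨σ, Nat.add_le_add_right (hL (hη hn)) 1, x, fun m hm1 hm2 => ?_⟩
  set n₀ := max n (G (4 * k + 3) + 1) with hn₀
  have hgn : g n = 4 * (k + 1) * (f σ + 1) := rfl
  have hfg : f σ + 1 ≤ g n := by
    rw [hgn]
    exact Nat.le_mul_of_pos_left _ (by positivity)
  have hX : (1 : ℝ) ≤ 4 * (D : ℝ) * ((k : ℝ) + 1) := by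
    have : 1 ≤ 4 * D * (k + 1) := Nat.mul_pos (by positivity) (by positivity)
    exact_mod_cast this
  obtain ⟨hn₀m, hprod⟩ := prod_one_sub_le (n := n₀) (m := m) (fun i => (h.lam_mem i).1.le)
    (fun i => (h.lam_mem i).2.le) hQ2 (by omega) hX hm1
  have hk4 : 1 / (((4 * k + 3 : ℕ) : ℝ) + 1) = 1 / (4 * ((k : ℝ) + 1)) := by
    push_cast
    congr 1
    ring
  rw [hk4] at hproj
  have hM2 : 4 * N ≤ M2 N₂ N₃ := by
    rw [M2, ← hN]
    omega
  have hM2' : (4 * N : ℝ) ≤ M2 N₂ N₃ := by exact_mod_cast hM2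
  have hM0 : (0 : ℝ) ≤ M2 N₂ N₃ := Nat.cast_nonneg _
  have hrec := recursive_bound (s := fun i => ‖z i - x‖ ^ 2) (lam := lam)
    (v := fun i => ‖resolvent T (cs i) x - x‖ * (‖resolvent T (cs i) x - x‖ + 4 * N))
    (err := fun i => M2 N₂ N₃ * ‖e i‖) (b := 1 / (4 * ((k : ℝ) + 1))) (n := n₀) (q := f σ)
    (fun i => (h.lam_mem i).1.le) (fun i => (h.lam_mem i).2.le) (fun i => by positivity)
    (fun i => by positivity) (by positivity)
    (fun i h1 h2 => by
      have h3 := h.norm_sq_succ_le hx hN2' i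
      have h4 := mul_le_mul_of_nonneg_left
        (hproj (i + 1) ((le_max_left _ _).trans (h1.trans (Nat.le_succ i))) (by omega))
        (h.lam_mem i).1.le
      have h5 := mul_le_mul_of_nonneg_right hM2' (norm_nonneg (e i))
      linarith) hn₀m hm2
  -- the four contributions
  have c1 : (∏ i ∈ Finset.Ico n₀ m, (1 - lam i)) * ‖z n₀ - x‖ ^ 2 ≤ 1 / (4 * ((k : ℝ) + 1)) := by
    have hD0 : (0 : ℝ) < D := by exact_mod_cast (by positivity : 0 < D)
    have h1 : ‖z n₀ - x‖ ^ 2 ≤ D := by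
      have h2 := norm_sub_le_norm_sub_add_norm_sub (z n₀) s x
      rw [norm_sub_rev s] at h2
      have h3 : ‖z n₀ - x‖ ≤ 2 * N := by linarith [h.norm_sub_zero_le n₀]
      refine (pow_le_pow_left₀ (norm_nonneg _) h3 2).trans_eq ?_
      rw [hD]
      push_cast
      ring
    refine (mul_le_mul hprod h1 (sq_nonneg _) (by positivity)).trans_eq ?_
    field_simp
  have c2 : ∑ i ∈ Finset.Ico n₀ m, ‖resolvent T (cs i) x - x‖ *
      (‖resolvent T (cs i) x - x‖ + 4 * N) ≤ 1 / (4 * ((k : ℝ) + 1)) := by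
    refine (Finset.sum_le_card_nsmul _ _ (1 / ((g n : ℝ) + 1)) fun i hi => hres i ?_).trans ?_
    · rw [Finset.mem_Ico] at hi
      omega
    · rw [Nat.card_Ico, nsmul_eq_mul, mul_one_div, div_le_div_iff₀ (by positivity) (by positivity),
        one_mul]
      have h1 : (m - n₀) * (4 * (k + 1)) ≤ g n + 1 := by
        rw [hgn]
        have : (m - n₀) * (4 * (k + 1)) ≤ (f σ + 1) * (4 * (k + 1)) :=
          Nat.mul_le_mul_right _ (by omega)
        linarith
      exact_mod_cast h1
  have c3 : ∑ i ∈ Finset.Ico n₀ m, (M2 N₂ N₃ : ℝ) * ‖e i‖ ≤ 1 / (4 * ((k : ℝ) + 1)) := by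
    rw [← Finset.mul_sum]
    have h1 : ∑ i ∈ Finset.Ico n₀ m, ‖e i‖ ≤
        1 / (((M2 N₂ N₃ * (4 * k + 3 + 1) : ℕ) : ℝ) + 1) := by
      refine le_trans ?_ (hq.sum_error_le (M2 N₂ N₃ * (4 * k + 3 + 1)) m)
      refine Finset.sum_le_sum_of_subset_of_nonneg (fun i hi => ?_) fun i _ _ => norm_nonneg _
      have : E (M2 N₂ N₃ * (4 * k + 3 + 1)) + 1 ≤ n₀ := le_max_right _ _
      rw [Finset.mem_Ico] at hi
      rw [Finset.mem_Icc]
      omega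
    refine (mul_le_mul_of_nonneg_left h1 hM0).trans ?_
    rw [mul_one_div, div_le_div_iff₀ (by positivity) (by positivity)]
    push_cast
    linarith
  have e1 : 1 / (4 * ((k : ℝ) + 1)) = 1 / 4 * (1 / (k + 1)) := by field_simp
  rw [e1] at hrec c1 c2 c3
  linarith

end IsIteration

theorem fmaj_mono (f : ℕ → ℕ) : Monotone (fmaj f) := fun _ _ hij =>
  Finset.sup_mono (Finset.range_mono (Nat.add_le_add_right hij 1))

theorem le_fmaj (f : ℕ → ℕ) (n : ℕ) : f n ≤ fmaj f n :=
  Finset.le_sup (f := f) (Finset.self_mem_range_succ n)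

end Convergence

end MPPA

theorem theorem4p9 {H : Type*} [NormedAddCommGroup H] [InnerProductSpace ℝ H] [CompleteSpace H]
    (T : H → Set H) (hT : MPPA.IsMaximalMonotone T)
    -- the iteration
    (lam γ δ cs : ℕ → ℝ) (u : H) (e z : ℕ → H)
    (hlam : ∀ n, lam n ∈ Set.Ioo (0 : ℝ) 1) (hγ : ∀ n, γ n ∈ Set.Ioo (0 : ℝ) 1)
    (hδ : ∀ n, δ n ∈ Set.Ioo (0 : ℝ) 1) (hsum : ∀ n, lam n + γ n + δ n = 1)
    (hcs : ∀ n, 0 < cs n)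
    (hz : ∀ n, z (n + 1) =
      lam n • u + γ n • z n + δ n • MPPA.resolvent T (cs n) (z n) + e n)
    -- the quantitative data
    (a c : ℕ) (ha : a ≠ 0) (hc : c ≠ 0)
    (ℓ L Γ E C : ℕ → ℕ) (hℓ : Monotone ℓ) (hL : Monotone L) (hΓ : Monotone Γ)
    (hE : Monotone E) (hC : Monotone C)
    (hQ1 : ∀ k n : ℕ, ℓ k ≤ n → lam n ≤ 1 / ((k : ℝ) + 1))
    (hQ2 : ∀ k : ℕ, (k : ℝ) ≤ ∑ i ∈ Finset.Icc 1 (L k), lam i)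
    (hQ3 : ∀ m : ℕ, 1 / (a : ℝ) ≤ γ m ∧ γ m ≤ 1 - 1 / (a : ℝ))
    (hQ4 : ∀ n : ℕ, 1 / (c : ℝ) ≤ cs n)
    (hQ5 : ∀ k n : ℕ, Γ k ≤ n → |cs (n + 1) - cs n| ≤ 1 / ((k : ℝ) + 1))
    (hQ6 : ∀ k n : ℕ, ∑ i ∈ Finset.Icc (E k + 1) (E k + n), ‖e i‖ ≤ 1 / ((k : ℝ) + 1))
    (hcsC : ∀ n, cs n ≤ (C n : ℝ))
    (N₁ N₂ N₃ : ℕ) (hN₁ : ‖u‖ ≤ (N₁ : ℝ))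
    (hN₂ : (∑ i ∈ Finset.range (E 0 + 1), ‖e i‖) + 1 ≤ (N₂ : ℝ))
    (hN₃ : ∃ s ∈ MPPA.zeros T, max ‖u - s‖ ‖z 0 - s‖ ≤ (N₃ : ℝ)) :
    ∀ (k : ℕ) (f : ℕ → ℕ), ∃ n ≤ MPPA.phi a c ℓ L Γ E C N₁ N₂ N₃ k f,
      ∀ i ∈ Set.Icc n (n + f n), ∀ j ∈ Set.Icc n (n + f n),
        ‖z i - z j‖ ≤ 1 / ((k : ℝ) + 1) := by
  intro k f
  obtain ⟨s, hs, hmax⟩ := hN₃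
  have h : MPPA.IsIteration T lam γ δ cs u e z s N₂ N₃ :=
    ⟨hT, hs, hlam, hγ, hδ, hsum, hcs, hz, (le_max_left _ _).trans hmax,
      (le_max_right _ _).trans hmax, MPPA.sum_range_error_le hQ6 hN₂⟩
  have hN₂0 : 0 < N₂ := by
    have h1 : 0 ≤ ∑ i ∈ Finset.range (E 0 + 1), ‖e i‖ := Finset.sum_nonneg fun i _ => norm_nonneg _
    have h2 : (0 : ℝ) < N₂ := by linarith
    exact_mod_cast h2
  obtain ⟨n, hn, x, hx⟩ := h.norm_sq_metastable ⟨ha, hc, hQ1, hQ3, hQ4, hQ5, hQ6⟩ hℓ hL hΓ hE hC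
    hQ2 hcsC hN₁ hN₂0 (4 * (k + 1) ^ 2 - 1) (f := fun m => m + MPPA.fmaj f m)
    fun i j hij => Nat.add_le_add hij (MPPA.fmaj_mono f hij)
  have hk : ((4 * (k + 1) ^ 2 - 1 : ℕ) : ℝ) + 1 = (2 * ((k : ℝ) + 1)) ^ 2 := by
    have h1 : 4 * (k + 1) ^ 2 - 1 + 1 = (2 * (k + 1)) ^ 2 := by
      rw [Nat.sub_add_cancel (Nat.mul_pos (by norm_num) (by positivity))]
      ring
    exact_mod_cast h1
  have hclose : ∀ i ∈ Set.Icc n (n + f n), ‖z i - x‖ ≤ 1 / (2 * ((k : ℝ) + 1)) := by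
    intro i hi
    have h1 := hx i hi.1 (hi.2.trans (Nat.add_le_add_left (MPPA.le_fmaj f n) n))
    rw [hk, ← one_div_pow] at h1
    exact (sq_le_sq₀ (norm_nonneg _) (by positivity)).1 h1
  refine ⟨n, hn, fun i hi j hj => ?_⟩
  have h1 := norm_sub_le_norm_sub_add_norm_sub (z i) x (z j)
  rw [norm_sub_rev x] at h1
  have e1 : 1 / (2 * ((k : ℝ) + 1)) + 1 / (2 * ((k : ℝ) + 1)) = 1 / ((k : ℝ) + 1) := by
    field_simp
    norm_num
  linarith [hclose i hi, hclose j hj]
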